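/- **Conventions.** Everything is bigraded by $\mathbb Z\times\mathbb Z$ (total degree, weight). Let $\mathbb M_2=\mathbb F_2[\rho,\tau]\oplus NC$ be the $C_2$-equivariant mod $2$ homology of a point, with $|\rho|=(-1,-1)$ and $|\tau|=(0,-1)$. Here $NC$ is a square-zero ideal with $\mathbb F_2$-basis $\frac{\gamma}{\rho^j\tau^k}$ ($j\ge 0$, $k\ge 1$) in bidegrees $(j,1+j+k)$, on which $\rho$ and $\tau$ act by lowering $j$ and $k$ by one (giving $0$ if this leaves the index range). Let $\mathcal E(1)$ be the $C_2$-equivariant algebra generated over $\mathbb M_2$ by the Milnor primitives $Q_0$ and $Q_1$, with $|Q_0|=(-1,0)$ and $|Q_1|=(-3,-1)$. It is free as an $\mathbb M_2$-module on $1,Q_0,Q_1,Q_0Q_1$, and its multiplication is determined by $$Q_0^2=Q_1^2=0,\quad Q_0Q_1=Q_1Q_0,\quad Q_0r=rQ_0+Q_0(r),\quad Q_1r=rQ_1+\rho\,Q_0(r)\,Q_0+Q_1(r)\qquad(r\in\mathbb M_2),$$ where $Q_0(\rho^a\tau^m)=m\,\rho^{a+1}\tau^{m-1}$ and $Q_1(\rho^a\tau^m)=\binom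 m2\rho^{a+3}\tau^{m-2}$, and where the same formulas hold on $NC$ with $\frac{\gamma}{\rho^j\tau^k}$ read as $\gamma\rho^{-j}\tau^{-k}$ (a result with a positive power of $\rho$ being $0$). A free bigraded $\mathcal E(1)$-module (or $\mathbb M_2$-module) is one with a basis of homogeneous elements. A map $f:M\to N$ of bigraded $\mathcal E(1)$-modules is a *stable equivalence* if there are free bigraded $\mathcal E(1)$-modules $P,Q$ and an isomorphism $M\oplus P\cong N\oplus Q$ of bigraded $\mathcal E(1)$-modules whose component $M\to N$ is $f$. For an $\mathcal E(1)$-module $M$, the submodule $(\rho,\tau)M=\rho M+\tau M$ is an $\mathcal E(1)$-submodule; write $M/(\rho,\tau)$ for the quotient and $f/(\rho,\tau)$ for the map of quotients induced by $f$. The *Margolis homology* of a module with respect to $Q_i$ is $\ker Q_i/\operatorname{im}Q_i$. **Proposition (Whitehead theorem).** Let $M$ and $N$ be finitely generated bigraded $\mathcal E(1)$-modules that are free over $\mathbb M_2$, and let $f:M\to N$ be a (degree-preserving) map of bigraded $\mathcal E(1)$-modules. Then $f$ is a stable equivalence if and only if $f/(\rho,\tau):M/(\rho,\tau)\to N/(\rho,\tau)$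 induces isomorphisms on Margolis homology with respect to $Q_0$ and with respect to $Q_1$. -/

import Mathlib

open Polynomial

universe u

namespace C2Equivariant

/-! ### The bigraded coefficient ring `M2` -/

/-- The positive cone `𝔽₂[ρ][τ]`: the outer variable is `τ`, the inner one is `ρ`. -/
abbrev PosCone : Type := Polynomial (Polynomial (ZMod 2))

/-- The negative cone, an `𝔽₂`-vector space whose basis element with index `(j, k)` is
`γ / (ρ ^ j * τ ^ (k + 1))`, for `j, k ≥ 0`. -/
def NegCone : Type := ℕ × ℕ →₀ ZMod 2

noncomputable instance : AddCommGroup NegCone := inferInstanceAs (AddCommGroup (ℕ × ℕ →₀ ZMod 2))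

noncomputable instance : Module (ZMod 2) NegCone :=
  inferInstanceAs (Module (ZMod 2) (ℕ × ℕ →₀ ZMod 2))

namespace NegCone

/-- The basis element `γ / (ρ ^ j * τ ^ (k + 1))`. -/
noncomputable def basisElt (j k : ℕ) : NegCone := Finsupp.single (j, k) (1 : ZMod 2)

/-- The coefficient of `γ / (ρ ^ j * τ ^ (k + 1))`. -/
def coeff (x : NegCone) (j k : ℕ) : ZMod 2 := DFunLike.coe (F := ℕ × ℕ →₀ ZMod 2) x (j, k)

/-- The linear map with prescribed values on the basis. -/
noncomputable def lift (v : ℕ → ℕ → NegCone) : NegCone →ₗ[ZMod 2] NegCone :=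
  Finsupp.linearCombination (ZMod 2) (fun p : ℕ × ℕ => v p.1 p.2)

theorem lift_basisElt (v : ℕ → ℕ → NegCone) (j k : ℕ) : lift v (basisElt j k) = v j k := by
  have h := Finsupp.linearCombination_single (ZMod 2) (v := fun p : ℕ × ℕ => v p.1 p.2)
    (1 : ZMod 2) (j, k)
  rw [one_smul] at h
  exact h

theorem hom_ext {f g : NegCone →ₗ[ZMod 2] NegCone}
    (h : ∀ j k, f (basisElt j k) = g (basisElt j k)) : f = g :=
  Finsupp.lhom_ext' fun p => LinearMap.ext_ring (h p.1 p.2)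

/-- Multiplication by `ρ`: it sends `γ / (ρ ^ j * τ ^ k)` to `γ / (ρ ^ (j - 1) * τ ^ k)`,
and to `0` if `j = 0`. -/
noncomputable def mulRho : NegCone →ₗ[ZMod 2] NegCone :=
  lift fun j k => if 1 ≤ j then basisElt (j - 1) k else 0

/-- Multiplication by `τ`: it sends `γ / (ρ ^ j * τ ^ k)` to `γ / (ρ ^ j * τ ^ (k - 1))`,
and to `0` if `k = 1`. -/
noncomputable def mulTau : NegCone →ₗ[ZMod 2] NegCone :=
  lift fun j k => if 1 ≤ k then basisElt j (k - 1) else 0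

theorem commute_mulRho_mulTau : Commute mulRho mulTau := by
  refine hom_ext fun j k => ?_
  simp only [Module.End.mul_apply, mulRho, mulTau, lift_basisElt]
  split_ifs <;> simp_all [lift_basisElt]

/-- The action of the positive cone on the negative cone. -/
noncomputable def actHom : PosCone →+* Module.End (ZMod 2) NegCone :=
  Polynomial.eval₂RingHom' (Polynomial.aeval mulRho).toRingHom mulTau (by
    intro a
    induction a using Polynomial.induction_on with
    | C a => simpa using Algebra.commute_algebraMap_left a mulTau
    | add p q hp hq => simpa using hp.add_left hq
    | monomial n a _ =>
      simpa using (Algebra.commute_algebraMap_left a mulTau).mul_left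
        (commute_mulRho_mulTau.pow_left (n + 1)))

noncomputable instance : Module PosCone NegCone := Module.compHom NegCone actHom

noncomputable instance : Module PosConeᵐᵒᵖ NegCone :=
  Module.compHom NegCone ((RingHom.id PosCone).fromOpposite fun _ _ => Commute.all _ _)

instance : IsCentralScalar PosCone NegCone := ⟨fun _ _ => rfl⟩

end NegCone

/-- The `C₂`-equivariant homology of a point: the square-zero extension of the positive cone
by the negative cone. -/
def M2 : Type := TrivSqZeroExt PosCone NegCone

noncomputable instance : CommRing M2 := inferInstanceAs (CommRing (TrivSqZeroExt PosCone NegCone))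

namespace M2

/-- The positive cone component. -/
def posC (x : M2) : PosCone := TrivSqZeroExt.fst x

/-- The negative cone component. -/
def negC (x : M2) : NegCone := TrivSqZeroExt.snd x

/-- The element with given components. -/
def mk (r : PosCone) (n : NegCone) : M2 := (r, n)

@[simp] theorem posC_mk (r : PosCone) (n : NegCone) : (mk r n).posC = r := rfl
@[simp] theorem negC_mk (r : PosCone) (n : NegCone) : (mk r n).negC = n := rfl
@[simp] theorem posC_zero : (0 : M2).posC = 0 := rfl
@[simp] theorem negC_zero : (0 : M2).negC = 0 := rfl
@[simp] theorem posC_one : (1 : M2).posC = 1 := rfl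
@[simp] theorem negC_one : (1 : M2).negC = 0 := rfl
@[simp] theorem posC_add (x y : M2) : (x + y).posC = x.posC + y.posC := rfl
@[simp] theorem negC_add (x y : M2) : (x + y).negC = x.negC + y.negC := rfl
@[simp] theorem posC_neg (x : M2) : (-x).posC = -x.posC := rfl
@[simp] theorem negC_neg (x : M2) : (-x).negC = -x.negC := rfl
@[simp] theorem posC_mul (x y : M2) : (x * y).posC = x.posC * y.posC := rfl
@[simp] theorem negC_mul (x y : M2) : (x * y).negC = x.posC • y.negC + y.posC • x.negC := rfl

@[ext] theorem ext {x y : M2} (h : x.posC = y.posC) (h' : x.negC = y.negC) : x = y :=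
  TrivSqZeroExt.ext h h'

noncomputable def rho : M2 := mk (C X) 0

noncomputable def tau : M2 := mk X 0

/-- The homogeneous elements of bidegree `d = (s, w)`, where `s` is the total degree and `w` is
the weight: `ρ ^ a * τ ^ b` has bidegree `(-a, -a - b)` and `γ / (ρ ^ j * τ ^ k)` has bidegree
`(j, 1 + j + k)`. -/
def grading (d : ℤ × ℤ) : AddSubgroup M2 where
  carrier := {x | (∀ a b : ℕ, (x.posC.coeff b).coeff a ≠ 0 → d = (-(a : ℤ), -(a : ℤ) - b)) ∧
    ∀ j k : ℕ, x.negC.coeff j k ≠ 0 → d = ((j : ℤ), 1 + j + ((k + 1 : ℕ) : ℤ))}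
  zero_mem' := ⟨fun _ _ h => absurd rfl h, fun _ _ h => absurd rfl h⟩
  add_mem' {x y} hx hy := by
    refine ⟨fun a b h => ?_, fun j k h => ?_⟩
    · by_contra hd
      have h1 := not_imp_comm.1 (hx.1 a b) hd
      have h2 := not_imp_comm.1 (hy.1 a b) hd
      exact h (by simp [h1, h2])
    · by_contra hd
      have h1 := not_imp_comm.1 (hx.2 j k) hd
      have h2 := not_imp_comm.1 (hy.2 j k) hd
      have h3 : (x + y).negC.coeff j k = x.negC.coeff j k + y.negC.coeff j k := rfl
      exact h (by rw [h3, h1, h2, add_zero])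
  neg_mem' {x} hx := by
    refine ⟨fun a b h => hx.1 a b fun h0 => h ?_, fun j k h => hx.2 j k fun h0 => h ?_⟩
    · simp [h0]
    · have h3 : (-x).negC.coeff j k = -x.negC.coeff j k := rfl
      rw [h3, h0, neg_zero]

/-- The operation `Q₀` on the negative cone: formally `τ ^ m ↦ m * ρ * τ ^ (m - 1)` with `m < 0`,
with coefficients modulo `2`. -/
noncomputable def negQ0 : NegCone →ₗ[ZMod 2] NegCone :=
  NegCone.lift fun j k =>
    if 1 ≤ j then ((k + 1 : ℕ) : ZMod 2) • NegCone.basisElt (j - 1) (k + 1) else 0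

/-- The operation `Q₁` on the negative cone: formally
`τ ^ m ↦ (m * (m - 1) / 2) * ρ ^ 3 * τ ^ (m - 2)` with `m < 0`, with coefficients modulo `2`;
note that `m * (m - 1) / 2` is `(k + 2).choose 2` for `m = - (k + 1)`. -/
noncomputable def negQ1 : NegCone →ₗ[ZMod 2] NegCone :=
  NegCone.lift fun j k =>
    if 3 ≤ j then ((k + 2).choose 2 : ZMod 2) • NegCone.basisElt (j - 3) (k + 2) else 0

/-- The operation `Q₀` on the homology of a point, that is, the coefficient of `τ₀` in the right
unit; on the positive cone it is `ρ ^ a * τ ^ m ↦ m * ρ ^ (a + 1) * τ ^ (m - 1)`. -/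
noncomputable def opQ0 (x : M2) : M2 :=
  mk (C X * hasseDeriv 1 x.posC) (negQ0 x.negC)

/-- The operation `Q₁` on the homology of a point, that is, the coefficient of `τ₁` in the right
unit; on the positive cone it is `ρ ^ a * τ ^ m ↦ (m.choose 2) * ρ ^ (a + 3) * τ ^ (m - 2)`. -/
noncomputable def opQ1 (x : M2) : M2 :=
  mk (C X ^ 3 * hasseDeriv 2 x.posC) (negQ1 x.negC)

theorem rho_smul (x : NegCone) : (C X : PosCone) • x = NegCone.mulRho x := by
  change NegCone.actHom (C X) x = _
  simp [NegCone.actHom]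

theorem tau_smul (x : NegCone) : (X : PosCone) • x = NegCone.mulTau x := by
  change NegCone.actHom X x = _
  simp [NegCone.actHom]

theorem const_smul (c : ZMod 2) (x : NegCone) : (C (C c) : PosCone) • x = c • x := by
  change NegCone.actHom (C (C c)) x = _
  simp [NegCone.actHom]

theorem smul_smul_comm (c : ZMod 2) (r : PosCone) (x : NegCone) : r • c • x = c • r • x :=
  (NegCone.actHom r).map_smul c x

theorem neg_add_self (x : NegCone) : x + x = 0 := by
  rw [← two_smul (ZMod 2) x, show (2 : ZMod 2) = 0 from rfl, zero_smul]

theorem pos_add_self (x : PosCone) : x + x = 0 := CharTwo.add_self_eq_zero x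

theorem add_self (x : M2) : x + x = 0 :=
  M2.ext (pos_add_self _) (neg_add_self _)

theorem opQ0_add (x y : M2) : opQ0 (x + y) = opQ0 x + opQ0 y := by
  ext1 <;> simp [opQ0, mul_add]

theorem opQ1_add (x y : M2) : opQ1 (x + y) = opQ1 x + opQ1 y := by
  ext1 <;> simp [opQ1, mul_add]

theorem negQ0_rho (x : NegCone) : negQ0 ((C X : PosCone) • x) = (C X : PosCone) • negQ0 x := by
  simp only [rho_smul]
  refine LinearMap.congr_fun (f := negQ0 ∘ₗ NegCone.mulRho) (g := NegCone.mulRho ∘ₗ negQ0)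
    (NegCone.hom_ext fun j k => ?_) x
  simp only [LinearMap.comp_apply, negQ0, NegCone.mulRho, NegCone.lift_basisElt]
  split_ifs <;> simp_all [NegCone.lift_basisElt]

theorem choose_add_two (k : ℕ) : (((k + 2).choose 2 : ℕ) : ZMod 2) = (k.choose 2 : ZMod 2) + 1 := by
  have h : (k + 2).choose 2 = k.choose 2 + 2 * k + 1 := by
    simp only [Nat.choose_succ_succ, Nat.choose_zero_right, Nat.choose_one_right]
    simp
    omega
  rw [h]
  push_cast
  rw [show (2 : ZMod 2) = 0 from rfl, zero_mul, add_zero]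

theorem negQ1_rho (x : NegCone) : negQ1 ((C X : PosCone) • x) = (C X : PosCone) • negQ1 x := by
  simp only [rho_smul]
  refine LinearMap.congr_fun (f := negQ1 ∘ₗ NegCone.mulRho) (g := NegCone.mulRho ∘ₗ negQ1)
    (NegCone.hom_ext fun j k => ?_) x
  simp only [LinearMap.comp_apply, negQ1, NegCone.mulRho, NegCone.lift_basisElt]
  rcases j with _ | _ | _ | _ | j <;> simp [NegCone.lift_basisElt]

theorem negQ0_tau (x : NegCone) :
    negQ0 ((X : PosCone) • x) = (C X : PosCone) • x + (X : PosCone) • negQ0 x := by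
  simp only [rho_smul, tau_smul]
  refine LinearMap.congr_fun (f := negQ0 ∘ₗ NegCone.mulTau)
    (g := NegCone.mulRho + NegCone.mulTau ∘ₗ negQ0) (NegCone.hom_ext fun j k => ?_) x
  simp only [LinearMap.comp_apply, LinearMap.add_apply, negQ0, NegCone.mulRho, NegCone.mulTau,
    NegCone.lift_basisElt]
  rcases j with _ | j <;> rcases k with _ | k <;>
    simp [NegCone.lift_basisElt, neg_add_self, add_smul]
  rw [add_assoc, neg_add_self, add_zero, add_comm]

theorem negQ1_tau (x : NegCone) :
    negQ1 ((X : PosCone) • x) = (C X : PosCone) ^ 2 • negQ0 x + (X : PosCone) • negQ1 x := by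
  simp only [rho_smul, tau_smul, pow_two, mul_smul]
  refine LinearMap.congr_fun (f := negQ1 ∘ₗ NegCone.mulTau)
    (g := NegCone.mulRho ∘ₗ NegCone.mulRho ∘ₗ negQ0 + NegCone.mulTau ∘ₗ negQ1)
    (NegCone.hom_ext fun j k => ?_) x
  simp only [LinearMap.comp_apply, LinearMap.add_apply, negQ0, negQ1, NegCone.mulRho,
    NegCone.mulTau, NegCone.lift_basisElt]
  rcases j with _ | _ | _ | j <;> rcases k with _ | k <;>
    simp [NegCone.lift_basisElt, neg_add_self]
  rw [show k + 1 + 1 = k + 2 from rfl, show k + 1 + 2 = (k + 1) + 2 from rfl, ← add_smul,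
    choose_add_two, choose_add_two, Nat.choose_succ_succ k 1, Nat.choose_one_right]
  congr 1
  push_cast
  generalize (k : ZMod 2) = a
  generalize (k.choose 2 : ZMod 2) = b
  revert a b
  decide

theorem negQ0_negQ0 (x : NegCone) : negQ0 (negQ0 x) = 0 := by
  refine LinearMap.congr_fun (f := negQ0 ∘ₗ negQ0) (g := 0) (NegCone.hom_ext fun j k => ?_) x
  simp only [LinearMap.comp_apply, LinearMap.zero_apply, negQ0, NegCone.lift_basisElt]
  rcases j with _ | _ | j <;>
    simp [NegCone.lift_basisElt, smul_smul]
  left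
  generalize (k : ZMod 2) = a
  revert a
  decide

theorem negQ1_negQ1 (x : NegCone) : negQ1 (negQ1 x) = 0 := by
  refine LinearMap.congr_fun (f := negQ1 ∘ₗ negQ1) (g := 0) (NegCone.hom_ext fun j k => ?_) x
  simp only [LinearMap.comp_apply, LinearMap.zero_apply, negQ1, NegCone.lift_basisElt]
  rcases j with _ | _ | _ | _ | _ | _ | j <;>
    simp [NegCone.lift_basisElt, smul_smul]
  left
  rw [choose_add_two, choose_add_two, choose_add_two]
  generalize (k.choose 2 : ZMod 2) = b
  revert b
  decide

theorem negQ0_negQ1 (x : NegCone) : negQ0 (negQ1 x) = negQ1 (negQ0 x) := by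
  refine LinearMap.congr_fun (f := negQ0 ∘ₗ negQ1) (g := negQ1 ∘ₗ negQ0)
    (NegCone.hom_ext fun j k => ?_) x
  simp only [LinearMap.comp_apply, negQ0, negQ1, NegCone.lift_basisElt]
  rcases j with _ | _ | _ | _ | j <;>
    simp [NegCone.lift_basisElt, smul_smul]
  rw [show k + 2 + 1 = k + 3 from rfl, show k + 1 + 2 = (k + 1) + 2 from rfl,
    choose_add_two, choose_add_two, Nat.choose_succ_succ k 1, Nat.choose_one_right]
  congr 1
  push_cast
  generalize (k : ZMod 2) = a
  generalize (k.choose 2 : ZMod 2) = b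
  revert a b
  decide

theorem hasseDeriv_one_mul (r s : PosCone) :
    hasseDeriv 1 (r * s) = r * hasseDeriv 1 s + hasseDeriv 1 r * s := by
  simp [add_comm]

theorem hasseDeriv_two_mul (r s : PosCone) : hasseDeriv 2 (r * s) =
    r * hasseDeriv 2 s + hasseDeriv 1 r * hasseDeriv 1 s + hasseDeriv 2 r * s := by
  simp [hasseDeriv_mul, Finset.Nat.sum_antidiagonal_succ, add_assoc]

/-- The compatibility of `Q₀` and `Q₁` with multiplication by `r` on the negative cone. -/
def NegCartan (r : PosCone) : Prop := ∀ x : NegCone,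
  negQ0 (r • x) = (C X * hasseDeriv 1 r) • x + r • negQ0 x ∧
  negQ1 (r • x) = (C X ^ 3 * hasseDeriv 2 r) • x + r • negQ1 x +
    (C X ^ 2 * hasseDeriv 1 r) • negQ0 x

theorem NegCartan.add {r s : PosCone} (hr : NegCartan r) (hs : NegCartan s) :
    NegCartan (r + s) := by
  intro x
  simp only [add_smul, map_add, hr x, hs x]
  constructor <;> module

theorem NegCartan.mul {r s : PosCone} (hr : NegCartan r) (hs : NegCartan s) :
    NegCartan (r * s) := by
  intro x
  simp only [mul_smul r s, hr _, hs _, hasseDeriv_one_mul, hasseDeriv_two_mul, smul_add]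
  constructor <;> module

theorem negCartan (r : PosCone) : NegCartan r := by
  have hc : ∀ c : ZMod 2, NegCartan (C (C c)) := fun c x => by
    simp [const_smul, hasseDeriv_C]
  have hrho : NegCartan (C X) := fun x => by
    simp [negQ0_rho, negQ1_rho, hasseDeriv_C]
  have htau : NegCartan X := fun x => by
    simp [negQ0_tau, negQ1_tau, hasseDeriv_X, add_comm]
  have hC : ∀ a : Polynomial (ZMod 2), NegCartan (C a) := fun a => by
    induction a using Polynomial.induction_on with
    | C c => exact hc c
    | add p q hp hq => rw [C_add]; exact hp.add hq
    | monomial n c h => rw [pow_succ, ← mul_assoc, C_mul]; exact h.mul hrho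
  induction r using Polynomial.induction_on with
  | C a => exact hC a
  | add p q hp hq => exact hp.add hq
  | monomial n a h => rw [pow_succ, ← mul_assoc]; exact h.mul htau

theorem opQ0_mul (x y : M2) : opQ0 (x * y) = opQ0 x * y + x * opQ0 y := by
  ext1
  · simp [opQ0, hasseDeriv_one_mul, -hasseDeriv_one]
    ring
  · simp [opQ0, (negCartan _ _).1, -hasseDeriv_one]
    module

/-- The Cartan formula for `Q₁`. -/
theorem opQ1_mul (x y : M2) :
    opQ1 (x * y) = opQ1 x * y + x * opQ1 y + rho * (opQ0 x * opQ0 y) := by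
  ext1
  · simp [opQ0, opQ1, rho, hasseDeriv_two_mul, -hasseDeriv_one]
    ring
  · simp [opQ0, opQ1, rho, (negCartan _ _).2, -hasseDeriv_one]
    module

theorem hasseDeriv_hasseDeriv (k l : ℕ) (r : PosCone) :
    hasseDeriv k (hasseDeriv l r) = (k + l).choose k • hasseDeriv (k + l) r :=
  LinearMap.congr_fun (hasseDeriv_comp k l) r

theorem two_nsmul_pos (n : ℕ) (r : PosCone) : (2 * n) • r = 0 := by
  rw [mul_nsmul, two_nsmul, pos_add_self, nsmul_zero]

theorem opQ0_opQ0 (x : M2) : opQ0 (opQ0 x) = 0 := by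
  ext1
  · simp only [opQ0, posC_mk, ← smul_eq_C_mul, map_smul, hasseDeriv_hasseDeriv]
    rw [show Nat.choose (1 + 1) 1 = 2 * 1 from rfl, two_nsmul_pos, smul_zero, smul_zero]
    rfl
  · simp [opQ0, negQ0_negQ0]

theorem opQ1_opQ1 (x : M2) : opQ1 (opQ1 x) = 0 := by
  ext1
  · simp only [opQ1, posC_mk, ← map_pow, ← smul_eq_C_mul, map_smul, hasseDeriv_hasseDeriv]
    rw [show Nat.choose (2 + 2) 2 = 2 * 3 from rfl, two_nsmul_pos, smul_zero, smul_zero]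
    rfl
  · simp [opQ1, negQ1_negQ1]

theorem opQ0_opQ1 (x : M2) : opQ0 (opQ1 x) = opQ1 (opQ0 x) := by
  ext1
  · simp only [opQ0, opQ1, posC_mk, ← map_pow, ← smul_eq_C_mul, map_smul, hasseDeriv_hasseDeriv]
    rw [smul_comm]
    rfl
  · simp [opQ0, opQ1, negQ0_negQ1]

theorem opQ0_rho : opQ0 rho = 0 := by
  ext1 <;> simp [opQ0, rho]

theorem opQ1_rho : opQ1 rho = 0 := by
  ext1 <;> simp [opQ1, rho, hasseDeriv_C]

theorem opQ0_tau : opQ0 tau = rho := by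
  ext1 <;> simp [opQ0, tau, rho]

theorem opQ1_tau : opQ1 tau = 0 := by
  ext1 <;> simp [opQ1, tau, hasseDeriv_X]

theorem opQ0_one : opQ0 1 = 0 := by
  ext1 <;> simp [opQ0]

theorem opQ1_one : opQ1 1 = 0 := by
  ext1 <;> simp [opQ1, hasseDeriv_apply_one]

theorem opQ0_zero : opQ0 0 = 0 := by
  ext1 <;> simp [opQ0]

theorem opQ1_zero : opQ1 0 = 0 := by
  ext1 <;> simp [opQ1]

end M2

/-! ### The algebra `E1` -/

/-- The `C₂`-equivariant algebra `ℰ(1)`, free as a left `M2`-module on `1, Q₀, Q₁, Q₀ Q₁`; the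
tuple `⟨a, b, c, d⟩` stands for `a + b Q₀ + c Q₁ + d Q₀ Q₁`. The multiplication is determined by
`Q₀² = Q₁² = 0`, `Q₀ Q₁ = Q₁ Q₀`, `Q₀ r = r Q₀ + opQ0 r` and
`Q₁ r = r Q₁ + ρ (opQ0 r) Q₀ + opQ1 r` for `r` in `M2`. It is the dual of the Hopf algebroid
`M2[τ₀, τ₁] / (τ₀² = ρ τ₁, τ₁² = 0)` with `τ₀`, `τ₁` primitive and with right unit
determined by `ρ ↦ ρ`, `τ ↦ τ + ρ τ₀`; that is, by `r ↦ r + (opQ0 r) τ₀ + (opQ1 r) τ₁ +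
(opQ0 (opQ1 r)) τ₀ τ₁`. -/
@[ext]
structure E1 where
  /-- the coefficient of `1` -/
  c0 : M2
  /-- the coefficient of `Q₀` -/
  c1 : M2
  /-- the coefficient of `Q₁` -/
  c2 : M2
  /-- the coefficient of `Q₀ Q₁` -/
  c3 : M2

namespace E1

noncomputable instance : Zero E1 := ⟨⟨0, 0, 0, 0⟩⟩
noncomputable instance : Add E1 := ⟨fun x y => ⟨x.c0 + y.c0, x.c1 + y.c1, x.c2 + y.c2, x.c3 + y.c3⟩⟩
noncomputable instance : Neg E1 := ⟨fun x => ⟨-x.c0, -x.c1, -x.c2, -x.c3⟩⟩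
noncomputable instance : SMul M2 E1 := ⟨fun r x => ⟨r * x.c0, r * x.c1, r * x.c2, r * x.c3⟩⟩

@[simp] theorem zero_c0 : (0 : E1).c0 = 0 := rfl
@[simp] theorem zero_c1 : (0 : E1).c1 = 0 := rfl
@[simp] theorem zero_c2 : (0 : E1).c2 = 0 := rfl
@[simp] theorem zero_c3 : (0 : E1).c3 = 0 := rfl
@[simp] theorem add_c0 (x y : E1) : (x + y).c0 = x.c0 + y.c0 := rfl
@[simp] theorem add_c1 (x y : E1) : (x + y).c1 = x.c1 + y.c1 := rfl
@[simp] theorem add_c2 (x y : E1) : (x + y).c2 = x.c2 + y.c2 := rfl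
@[simp] theorem add_c3 (x y : E1) : (x + y).c3 = x.c3 + y.c3 := rfl
@[simp] theorem neg_c0 (x : E1) : (-x).c0 = -x.c0 := rfl
@[simp] theorem neg_c1 (x : E1) : (-x).c1 = -x.c1 := rfl
@[simp] theorem neg_c2 (x : E1) : (-x).c2 = -x.c2 := rfl
@[simp] theorem neg_c3 (x : E1) : (-x).c3 = -x.c3 := rfl
@[simp] theorem smul_c0 (r : M2) (x : E1) : (r • x).c0 = r * x.c0 := rfl
@[simp] theorem smul_c1 (r : M2) (x : E1) : (r • x).c1 = r * x.c1 := rfl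
@[simp] theorem smul_c2 (r : M2) (x : E1) : (r • x).c2 = r * x.c2 := rfl
@[simp] theorem smul_c3 (r : M2) (x : E1) : (r • x).c3 = r * x.c3 := rfl

noncomputable instance : AddCommGroup E1 where
  add_assoc x y z := by ext1 <;> simp [add_assoc]
  zero_add x := by ext1 <;> simp
  add_zero x := by ext1 <;> simp
  add_comm x y := by ext1 <;> simp [add_comm]
  neg_add_cancel x := by ext1 <;> simp
  nsmul := nsmulRec
  zsmul := zsmulRec

noncomputable instance : Module M2 E1 where
  one_smul x := by ext1 <;> simp
  mul_smul r s x := by ext1 <;> simp [mul_assoc]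
  smul_zero r := by ext1 <;> simp
  smul_add r x y := by ext1 <;> simp [mul_add]
  add_smul r s x := by ext1 <;> simp [add_mul]
  zero_smul x := by ext1 <;> simp

/-- Left multiplication by `Q₀`. -/
noncomputable def leftQ0 (x : E1) : E1 where
  c0 := M2.opQ0 x.c0
  c1 := x.c0 + M2.opQ0 x.c1
  c2 := M2.opQ0 x.c2
  c3 := x.c2 + M2.opQ0 x.c3

/-- Left multiplication by `Q₁`. -/
noncomputable def leftQ1 (x : E1) : E1 where
  c0 := M2.opQ1 x.c0
  c1 := M2.rho * M2.opQ0 x.c0 + M2.opQ1 x.c1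
  c2 := x.c0 + M2.opQ1 x.c2
  c3 := x.c1 + M2.rho * M2.opQ0 x.c2 + M2.opQ1 x.c3

noncomputable instance : Mul E1 :=
  ⟨fun x y => x.c0 • y + x.c1 • leftQ0 y + x.c2 • leftQ1 y + x.c3 • leftQ0 (leftQ1 y)⟩

noncomputable instance : One E1 := ⟨⟨1, 0, 0, 0⟩⟩

@[simp] theorem one_c0 : (1 : E1).c0 = 1 := rfl
@[simp] theorem one_c1 : (1 : E1).c1 = 0 := rfl
@[simp] theorem one_c2 : (1 : E1).c2 = 0 := rfl
@[simp] theorem one_c3 : (1 : E1).c3 = 0 := rfl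

theorem mul_def (x y : E1) :
    x * y = x.c0 • y + x.c1 • leftQ0 y + x.c2 • leftQ1 y + x.c3 • leftQ0 (leftQ1 y) := rfl

theorem add_self (x : E1) : x + x = 0 := by ext1 <;> exact M2.add_self _

theorem leftQ0_add (x y : E1) : leftQ0 (x + y) = leftQ0 x + leftQ0 y := by
  ext1 <;> simp [leftQ0, M2.opQ0_add, add_add_add_comm]

theorem leftQ1_add (x y : E1) : leftQ1 (x + y) = leftQ1 x + leftQ1 y := by
  ext1 <;> simp [leftQ1, M2.opQ0_add, M2.opQ1_add, mul_add, add_add_add_comm]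

theorem leftQ0_smul (r : M2) (x : E1) : leftQ0 (r • x) = M2.opQ0 r • x + r • leftQ0 x := by
  ext1 <;> simp [leftQ0, M2.opQ0_mul] <;> ring

theorem leftQ1_smul (r : M2) (x : E1) :
    leftQ1 (r • x) = M2.opQ1 r • x + r • leftQ1 x + (M2.rho * M2.opQ0 r) • leftQ0 x := by
  ext1 <;> simp [leftQ0, leftQ1, M2.opQ0_mul, M2.opQ1_mul]
  · ring
  · linear_combination M2.add_self 0
  · ring
  · ring

theorem leftQ0_leftQ0 (x : E1) : leftQ0 (leftQ0 x) = 0 := by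
  ext1 <;> simp [leftQ0, M2.opQ0_add, M2.opQ0_opQ0, M2.add_self]

theorem opQ0_rho_mul (r : M2) : M2.opQ0 (M2.rho * r) = M2.rho * M2.opQ0 r := by
  rw [M2.opQ0_mul, M2.opQ0_rho, zero_mul, zero_add]

theorem opQ1_rho_mul (r : M2) : M2.opQ1 (M2.rho * r) = M2.rho * M2.opQ1 r := by
  rw [M2.opQ1_mul, M2.opQ1_rho, M2.opQ0_rho, zero_mul, zero_mul, mul_zero, zero_add, add_zero]

theorem leftQ1_leftQ1 (x : E1) : leftQ1 (leftQ1 x) = 0 := by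
  ext1 <;> simp [leftQ1, M2.opQ0_add, M2.opQ1_add, M2.opQ1_opQ1, M2.opQ0_opQ1,
    opQ1_rho_mul, M2.add_self, mul_add]
  linear_combination M2.add_self (M2.rho * M2.opQ0 x.c0) + M2.add_self (M2.opQ1 x.c1) +
    M2.add_self (M2.rho * M2.opQ1 (M2.opQ0 x.c2))

theorem leftQ0_leftQ1 (x : E1) : leftQ0 (leftQ1 x) = leftQ1 (leftQ0 x) := by
  ext1 <;> simp [leftQ0, leftQ1, M2.opQ0_add, M2.opQ1_add, M2.opQ0_opQ1, opQ0_rho_mul,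
    M2.opQ0_opQ0, add_assoc, add_left_comm]

theorem leftQ0_zero : leftQ0 0 = 0 := by ext1 <;> simp [leftQ0, M2.opQ0_zero]

theorem leftQ1_zero : leftQ1 0 = 0 := by
  ext1 <;> simp [leftQ1, M2.opQ0_zero, M2.opQ1_zero]

theorem smul_mul (r : M2) (x y : E1) : (r • x) * y = r • (x * y) := by
  simp only [mul_def, smul_c0, smul_c1, smul_c2, smul_c3, smul_add, mul_smul]

theorem add_mul' (x y z : E1) : (x + y) * z = x * z + y * z := by
  simp only [mul_def, add_c0, add_c1, add_c2, add_c3, add_smul]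
  abel

theorem leftQ0_mul (x y : E1) : leftQ0 x * y = leftQ0 (x * y) := by
  simp only [mul_def, leftQ0_add, leftQ0_smul, leftQ0_leftQ0, smul_zero, add_zero]
  simp only [leftQ0, add_smul]
  abel

theorem leftQ1_mul (x y : E1) : leftQ1 x * y = leftQ1 (x * y) := by
  simp only [mul_def, leftQ1_add, leftQ1_smul, leftQ0_leftQ0, ← leftQ0_leftQ1, leftQ1_leftQ1,
    leftQ0_zero, smul_zero, add_zero]
  simp only [leftQ1, add_smul]
  abel

noncomputable instance : Ring E1 where
  left_distrib x y z := by
    simp only [mul_def, leftQ0_add, leftQ1_add, smul_add]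
    abel
  right_distrib := add_mul'
  zero_mul x := by simp [mul_def]
  mul_zero x := by simp [mul_def, leftQ0_zero, leftQ1_zero]
  mul_assoc x y z := by
    rw [mul_def x y, mul_def x (y * z)]
    simp only [add_mul', smul_mul, leftQ0_mul, leftQ1_mul]
  one_mul x := by
    simp [mul_def]
  mul_one x := by
    have h0 : leftQ0 1 = ⟨0, 1, 0, 0⟩ := by
      ext1 <;> simp [leftQ0, M2.opQ0_one, M2.opQ0_zero]
    have h1 : leftQ1 1 = ⟨0, 0, 1, 0⟩ := by
      ext1 <;> simp [leftQ1, M2.opQ0_one, M2.opQ1_one, M2.opQ0_zero, M2.opQ1_zero]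
    have h2 : leftQ0 ⟨0, 0, 1, 0⟩ = ⟨0, 0, 0, 1⟩ := by
      ext1 <;> simp [leftQ0, M2.opQ0_one, M2.opQ0_zero]
    rw [mul_def, h0, h1, h2]
    ext1 <;> simp
  neg_add_cancel := neg_add_cancel
  zsmul := zsmulRec


/-- The inclusion of the coefficients. -/
noncomputable def ofM2 : M2 →+* E1 where
  toFun r := ⟨r, 0, 0, 0⟩
  map_zero' := rfl
  map_one' := rfl
  map_add' r s := by ext1 <;> simp
  map_mul' r s := by
    rw [mul_def]
    ext1 <;> simp

/-- The Milnor primitives `Q₀` and `Q₁`. -/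
noncomputable def Q : Fin 2 → E1 := ![⟨0, 1, 0, 0⟩, ⟨0, 0, 1, 0⟩]

theorem Q_mul_self (i : Fin 2) : Q i * Q i = 0 := by
  fin_cases i <;> simp only [mul_def] <;> ext1 <;>
    simp [Q, leftQ0, leftQ1, M2.opQ0_zero, M2.opQ1_zero, M2.opQ0_one, M2.opQ1_one]

/-- The homogeneous elements of a given bidegree, where `Q₀` has bidegree `(-1, 0)` and `Q₁` has
bidegree `(-3, -1)`. -/
def grading (d : ℤ × ℤ) : AddSubgroup E1 where
  carrier := {x | x.c0 ∈ M2.grading d ∧ x.c1 ∈ M2.grading (d + (1, 0)) ∧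
    x.c2 ∈ M2.grading (d + (3, 1)) ∧ x.c3 ∈ M2.grading (d + (4, 1))}
  zero_mem' := ⟨zero_mem _, zero_mem _, zero_mem _, zero_mem _⟩
  add_mem' hx hy := ⟨add_mem hx.1 hy.1, add_mem hx.2.1 hy.2.1, add_mem hx.2.2.1 hy.2.2.1,
    add_mem hx.2.2.2 hy.2.2.2⟩
  neg_mem' hx := ⟨neg_mem hx.1, neg_mem hx.2.1, neg_mem hx.2.2.1, neg_mem hx.2.2.2⟩

theorem rho_comm (a : E1) : a * ofM2 M2.rho = ofM2 M2.rho * a := by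
  simp only [mul_def]
  ext1 <;> simp [ofM2, leftQ0, leftQ1, M2.opQ0_rho, M2.opQ1_rho, M2.opQ0_zero, M2.opQ1_zero,
    mul_comm]

theorem mul_tau (a : E1) : a * ofM2 M2.tau =
    ofM2 M2.tau * a + ofM2 M2.rho * ⟨a.c1, M2.rho * a.c2, a.c3, 0⟩ := by
  simp only [mul_def]
  ext1 <;> simp [ofM2, leftQ0, leftQ1, M2.opQ0_tau, M2.opQ1_tau, M2.opQ0_rho,
    M2.opQ0_zero, M2.opQ1_zero, opQ0_rho_mul] <;> ring

theorem two_eq_zero : (2 : M2) = 0 := by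
  rw [← one_add_one_eq_two, M2.add_self]

theorem three_eq_one : (3 : M2) = 1 := by
  rw [← two_add_one_eq_three, two_eq_zero, zero_add]

theorem four_eq_zero : (4 : M2) = 0 := by
  rw [← two_add_two_eq_four, two_eq_zero, zero_add]

/-- The map `a + b Q₀ + c Q₁ + d Q₀ Q₁ ↦ a + Q₀ b + Q₁ c + Q₀ Q₁ d`. -/
noncomputable def opp (x : E1) : E1 :=
  ofM2 x.c0 + leftQ0 (ofM2 x.c1) + leftQ1 (ofM2 x.c2) + leftQ0 (leftQ1 (ofM2 x.c3))

theorem opp_mul (x y : E1) : opp (x * y) = opp y * opp x := by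
  simp only [opp, mul_def]
  ext1 <;> simp [ofM2, leftQ0, leftQ1, M2.opQ0_mul, M2.opQ1_mul, M2.opQ0_add, M2.opQ1_add,
      M2.opQ0_opQ0, M2.opQ1_opQ1, M2.opQ0_opQ1, M2.opQ0_rho, M2.opQ1_rho, M2.opQ0_zero,
      M2.opQ1_zero] <;>
    ring_nf <;> simp only [two_eq_zero, three_eq_one, four_eq_zero, mul_zero, add_zero, mul_one]

theorem opp_opp (x : E1) : opp (opp x) = x := by
  simp only [opp]
  ext1 <;> simp [ofM2, leftQ0, leftQ1, M2.opQ0_mul, M2.opQ0_add, M2.opQ1_add, M2.opQ0_opQ0,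
      M2.opQ0_opQ1, M2.opQ0_rho, M2.opQ0_zero, M2.opQ1_zero] <;>
    ring_nf <;> simp only [two_eq_zero, four_eq_zero, mul_zero, add_zero]

theorem opp_add (x y : E1) : opp (x + y) = opp x + opp y := by
  simp only [opp, add_c0, add_c1, add_c2, add_c3, map_add, leftQ0_add, leftQ1_add]
  abel

/-- The algebra `E1` is isomorphic to its opposite by an isomorphism that is the identity on `M2`,
`Q₀` and `Q₁` (see the next two facts), so right modules are the same as left modules. -/
noncomputable def equivOp : E1 ≃+* E1ᵐᵒᵖ where
  toFun x := MulOpposite.op (opp x)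
  invFun x := opp x.unop
  left_inv := opp_opp
  right_inv x := congrArg MulOpposite.op (opp_opp x.unop)
  map_mul' x y := congrArg MulOpposite.op (opp_mul x y)
  map_add' x y := congrArg MulOpposite.op (opp_add x y)

theorem equivOp_Q (i : Fin 2) : equivOp (Q i) = MulOpposite.op (Q i) := by
  refine congrArg MulOpposite.op ?_
  fin_cases i <;> ext1 <;>
    simp [opp, Q, ofM2, leftQ0, leftQ1, M2.opQ0_zero, M2.opQ1_zero, M2.opQ0_one, M2.opQ1_one]

theorem equivOp_ofM2 (r : M2) : equivOp (ofM2 r) = MulOpposite.op (ofM2 r) := by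
  refine congrArg MulOpposite.op ?_
  ext1 <;> simp [opp, ofM2, leftQ0, leftQ1, M2.opQ0_zero, M2.opQ1_zero]

end E1


/-! ### Graded modules -/

section Modules

/-- `ℳ` makes the `E1`-module `M` a bigraded module. -/
structure IsGraded {M : Type u} [AddCommGroup M] [Module E1 M]
    (ℳ : ℤ × ℤ → AddSubgroup M) : Prop where
  isInternal : DirectSum.IsInternal ℳ
  smul_mem : ∀ (d e : ℤ × ℤ) (a : E1) (x : M),
    a ∈ E1.grading d → x ∈ ℳ e → a • x ∈ ℳ (d + e)

/-- A bigraded `E1`-module is free if it has a basis of homogeneous elements, that is, if it is a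
direct sum of suspensions of `E1`. -/
def IsGradedFree {M : Type u} [AddCommGroup M] [Module E1 M]
    (ℳ : ℤ × ℤ → AddSubgroup M) : Prop :=
  ∃ (ι : Type u) (b : Module.Basis ι E1 M), ∀ i, ∃ d, b i ∈ ℳ d

/-- A bigraded `E1`-module is `M2`-free if, by restriction of scalars, it has a basis over `M2`
of homogeneous elements. -/
def IsGradedM2Free {M : Type u} [AddCommGroup M] [Module E1 M]
    (ℳ : ℤ × ℤ → AddSubgroup M) : Prop :=
  letI : Module M2 M := Module.compHom M E1.ofM2
  ∃ (ι : Type u) (b : Module.Basis ι M2 M), ∀ i, ∃ d, b i ∈ ℳ d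

/-- `f` preserves the bidegree. -/
def PreservesDegree {M N : Type u} [AddCommGroup M] [Module E1 M] [AddCommGroup N] [Module E1 N]
    (ℳ : ℤ × ℤ → AddSubgroup M) (𝒩 : ℤ × ℤ → AddSubgroup N) (f : M →ₗ[E1] N) : Prop :=
  ∀ (d : ℤ × ℤ) (x : M), x ∈ ℳ d → f x ∈ 𝒩 d

/-- The map `f` is a stable equivalence: there are free bigraded modules `P`, `Q` and an
isomorphism `M ⊕ P ≅ N ⊕ Q` of bigraded modules whose component `M → N` is `f`. -/
def IsStableEquiv {M N : Type u} [AddCommGroup M] [Module E1 M] [AddCommGroup N] [Module E1 N]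
    (ℳ : ℤ × ℤ → AddSubgroup M) (𝒩 : ℤ × ℤ → AddSubgroup N) (f : M →ₗ[E1] N) : Prop :=
  ∃ (P Q : Type u) (_ : AddCommGroup P) (_ : Module E1 P) (_ : AddCommGroup Q) (_ : Module E1 Q)
    (gP : ℤ × ℤ → AddSubgroup P) (gQ : ℤ × ℤ → AddSubgroup Q) (g : (M × P) ≃ₗ[E1] (N × Q)),
    IsGraded gP ∧ IsGradedFree gP ∧ IsGraded gQ ∧ IsGradedFree gQ ∧
    PreservesDegree (fun d => (ℳ d).prod (gP d)) (fun d => (𝒩 d).prod (gQ d)) g.toLinearMap ∧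
    ∀ x : M, (g (x, 0)).1 = f x

/-- The submodule `(ρ, τ) M = ρ M + τ M`. -/
noncomputable def rhoTau (M : Type u) [AddCommGroup M] [Module E1 M] : Submodule E1 M where
  carrier := {z | ∃ x y : M, z = E1.ofM2 M2.rho • x + E1.ofM2 M2.tau • y}
  zero_mem' := ⟨0, 0, by simp⟩
  add_mem' := by
    rintro _ _ ⟨x, y, rfl⟩ ⟨x', y', rfl⟩
    exact ⟨x + x', y + y', by simp only [smul_add]; abel⟩
  smul_mem' := by
    rintro a _ ⟨x, y, rfl⟩
    refine ⟨a • x + (⟨a.c1, M2.rho * a.c2, a.c3, 0⟩ : E1) • y, a • y, ?_⟩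
    rw [smul_add, smul_smul, smul_smul, E1.rho_comm, E1.mul_tau]
    simp only [smul_add, add_smul, mul_smul]
    abel

/-- The quotient `M / (ρ, τ)`. -/
abbrev ModRhoTau (M : Type u) [AddCommGroup M] [Module E1 M] : Type u := M ⧸ rhoTau M

/-- The map `f / (ρ, τ) : M / (ρ, τ) → N / (ρ, τ)`. -/
noncomputable def mapModRhoTau {M N : Type u} [AddCommGroup M] [Module E1 M] [AddCommGroup N] [Module E1 N]
    (f : M →ₗ[E1] N) : ModRhoTau M →ₗ[E1] ModRhoTau N :=
  Submodule.mapQ (rhoTau M) (rhoTau N) f (by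
    rintro _ ⟨x, y, rfl⟩
    exact ⟨f x, f y, by simp⟩)

/-- The Margolis homology `ker q / im q` of a module with respect to `q` (used for `q = Q₀, Q₁`,
which have square zero). -/
abbrev MargolisHomology (q : E1) (M : Type u) [AddCommGroup M] [Module E1 M] : Type u :=
  (DistribSMul.toAddMonoidHom M q).ker ⧸
    (DistribSMul.toAddMonoidHom M q).range.addSubgroupOf (DistribSMul.toAddMonoidHom M q).ker

/-- The map induced by `f` on Margolis homology. -/
noncomputable def mapMargolis (q : E1) {M N : Type u} [AddCommGroup M] [Module E1 M] [AddCommGroup N]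
    [Module E1 N] (f : M →ₗ[E1] N) : MargolisHomology q M →+ MargolisHomology q N :=
  QuotientAddGroup.map _ _
    ((f.toAddMonoidHom.comp (DistribSMul.toAddMonoidHom M q).ker.subtype).codRestrict
      (DistribSMul.toAddMonoidHom N q).ker (fun x => by
        have hx : q • (x : M) = 0 := x.2
        change q • f x = 0
        rw [← map_smul, hx, map_zero]))
    (by
      rintro ⟨x, hx⟩ ⟨y, hy⟩
      exact ⟨f y, by
        change q • f y = f x
        rw [← map_smul]
        exact congrArg f hy⟩)

end Modules

end C2Equivariant

/-!
A free `E1`-module has zero Margolis homology modulo `(ρ, τ)`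
(`isAcyclicMod_rhoTau_of_basis`), so adding free summands does not change the Margolis homology, and
a stable equivalence induces isomorphisms.

For the converse, `E1` is a Frobenius extension of `M2`: an `M2`-linear functional on `M` is the
coefficient of `Q₀ Q₁` in an `E1`-linear map from `M` to `E1` (`coinduced`). The coordinates of `M`
with respect to an `M2`-basis therefore give an `E1`-linear map from `M` to a free module that is
split injective over `M2`. Adding it to `f` gives a map `g : M → B`, where `B` is the sum of `N` and
a free module, which is injective modulo `(ρ, τ)` and still induces isomorphisms on Margolis homology.
Hence the quotient of `B` by `(ρ, τ) B` and the image of `g` has zero Margolis homology.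

That quotient is a finite bigraded module over the exterior algebra on `Q₀` and `Q₁` with zero
Margolis homology, so it is free (`exists_free_generators`). The grading is essential here: since
`Q₁` lowers the weight and `Q₀` does not, an element killed by `Q₀ Q₁` is seen to be in the sum of the
images of `Q₀` and `Q₁` by induction on the weight (`exists_of_Q_smul_mem`).

Lifts of the free generators to `B` extend `g` to a map from the sum of `M` and a free module to `B`
that is an isomorphism modulo `(ρ, τ)`. It is an isomorphism by Nakayama's lemma
(`bijective_of_bijective_mod_rhoTau`), which does not need the ideal `(ρ, τ)` to be nilpotent
or the degrees of `M2` to be bounded on one side: the determinant of the map over `M2` is homogeneous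
and is nonzero modulo `(ρ, τ)`, and the only such element of `M2` is `1`.
-/

namespace C2Equivariant

/-! ### The bigraded rings `M2` and `E1` -/

namespace NegCone

@[simp] theorem coeff_zero (j k : ℕ) : coeff 0 j k = 0 := rfl

theorem coeff_basisElt (j k j' k' : ℕ) :
    coeff (basisElt j k) j' k' = if j = j' ∧ k = k' then 1 else 0 := by
  simp only [coeff, basisElt]
  erw [Finsupp.single_apply]
  simp [Prod.ext_iff]

theorem ext_coeff {x y : NegCone} (h : ∀ j k, coeff x j k = coeff y j k) : x = y :=
  Finsupp.ext fun p => h p.1 p.2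

@[elab_as_elim]
theorem induction_basisElt {p : NegCone → Prop} (x : NegCone) (zero : p 0)
    (add : ∀ x y, p x → p y → p (x + y)) (basis : ∀ j k, p (basisElt j k)) : p x := by
  refine Finsupp.induction_linear (motive := p) x zero add fun i c => ?_
  have hc : c = 0 ∨ c = 1 := by revert c; decide
  rcases hc with rfl | rfl
  · rw [Finsupp.single_zero]; exact zero
  · exact basis i.1 i.2

end NegCone

namespace M2

theorem zero_or_eq_one (c : ZMod 2) : c = 0 ∨ c = 1 := by revert c; decide

theorem posC_monomial (a b : ℕ) : (rho ^ a * tau ^ b).posC = C (X ^ a) * X ^ b := by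
  have hr : ∀ (x : M2) (n : ℕ), (x ^ n).posC = x.posC ^ n := fun x n => by
    induction n with
    | zero => simp
    | succ n ih => rw [pow_succ, posC_mul, ih, pow_succ]
  simp [hr, rho, tau]

theorem negC_monomial (a b : ℕ) : (rho ^ a * tau ^ b).negC = 0 := by
  have hr : ∀ (x : M2) (n : ℕ), x.negC = 0 → (x ^ n).negC = 0 := fun x n hx => by
    induction n with
    | zero => simp
    | succ n ih => rw [pow_succ, negC_mul, ih, hx, smul_zero, smul_zero, add_zero]
  rw [negC_mul, hr _ _ rfl, hr _ _ rfl, smul_zero, smul_zero, add_zero]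

theorem coeff_posC_monomial (a b a' b' : ℕ) : ((rho ^ a * tau ^ b).posC.coeff b').coeff a' =
    if a' = a ∧ b' = b then 1 else 0 := by
  rw [posC_monomial, coeff_C_mul_X_pow]
  split_ifs <;> simp_all [coeff_X_pow]

theorem monomial_mem_grading (a b : ℕ) :
    rho ^ a * tau ^ b ∈ grading (-(a : ℤ), -(a : ℤ) - b) := by
  refine ⟨fun a' b' h => ?_, fun j k h => absurd ?_ h⟩
  · rw [coeff_posC_monomial] at h
    split_ifs at h with hab
    · rw [hab.1, hab.2]
    · exact absurd rfl h
  · rw [negC_monomial, NegCone.coeff_zero]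

theorem basisElt_mem_grading (j k : ℕ) :
    mk 0 (NegCone.basisElt j k) ∈ grading ((j : ℤ), 1 + j + ((k + 1 : ℕ) : ℤ)) := by
  refine ⟨fun a b h => absurd (by simp) h, fun j' k' h => ?_⟩
  rw [negC_mk, NegCone.coeff_basisElt] at h
  split_ifs at h with hab
  · rw [hab.1, hab.2]
  · exact absurd rfl h

/-- Distinct basis elements `ρ ^ a * τ ^ b` and `γ / (ρ ^ j * τ ^ k)` have distinct bidegrees, and
the coefficients are in `𝔽₂`, so each bidegree has at most one nonzero element. -/
theorem eq_of_mem_grading {d : ℤ × ℤ} {x : M2} (hx : x ∈ grading d) :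
    x = 0 ∨ (∃ a b : ℕ, d = (-(a : ℤ), -(a : ℤ) - b) ∧ x = rho ^ a * tau ^ b) ∨
      ∃ j k : ℕ, d = ((j : ℤ), 1 + j + ((k + 1 : ℕ) : ℤ)) ∧ x = mk 0 (NegCone.basisElt j k) := by
  by_cases hp : ∃ a b, (x.posC.coeff b).coeff a ≠ 0
  · obtain ⟨a, b, hab⟩ := hp
    have hd := hx.1 a b hab
    refine Or.inr (Or.inl ⟨a, b, hd, M2.ext ?_ ?_⟩)
    · refine Polynomial.ext fun b' => Polynomial.ext fun a' => ?_
      rw [coeff_posC_monomial]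
      split_ifs with h
      · rw [h.1, h.2]
        exact (zero_or_eq_one _).resolve_left hab
      · by_contra h'
        have := hd.symm.trans (hx.1 a' b' h')
        simp only [Prod.mk.injEq] at this
        omega
    · rw [negC_monomial]
      refine NegCone.ext_coeff fun j k => ?_
      by_contra h'
      have := hd.symm.trans (hx.2 j k h')
      simp only [Prod.mk.injEq] at this
      omega
  · push Not at hp
    have h0 : x.posC = 0 := Polynomial.ext fun b' => Polynomial.ext fun a' => by simp [hp]
    by_cases hn : ∃ j k, x.negC.coeff j k ≠ 0
    · obtain ⟨j, k, hjk⟩ := hn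
      have hd := hx.2 j k hjk
      refine Or.inr (Or.inr ⟨j, k, hd, M2.ext h0 (NegCone.ext_coeff fun j' k' => ?_)⟩)
      rw [negC_mk, NegCone.coeff_basisElt]
      split_ifs with h
      · rw [← h.1, ← h.2]
        exact (zero_or_eq_one _).resolve_left hjk
      · by_contra h'
        have := hd.symm.trans (hx.2 j' k' h')
        simp only [Prod.mk.injEq] at this
        omega
    · push Not at hn
      exact Or.inl (M2.ext h0 (NegCone.ext_coeff fun j k => by simp [hn]))

theorem rho_mul_basisElt (j k : ℕ) : rho * mk 0 (NegCone.basisElt j k) =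
    if 1 ≤ j then mk 0 (NegCone.basisElt (j - 1) k) else 0 := by
  split_ifs with h <;> ext1 <;> simp [rho, rho_smul, NegCone.mulRho, NegCone.lift_basisElt, h]

theorem tau_mul_basisElt (j k : ℕ) : tau * mk 0 (NegCone.basisElt j k) =
    if 1 ≤ k then mk 0 (NegCone.basisElt j (k - 1)) else 0 := by
  split_ifs with h <;> ext1 <;> simp [tau, tau_smul, NegCone.mulTau, NegCone.lift_basisElt, h]

theorem mem_grading_of_eq {d e : ℤ × ℤ} {x : M2} (hx : x ∈ grading d) (h : d = e) :
    x ∈ grading e := h ▸ hx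

theorem rho_mul_mem_grading {d : ℤ × ℤ} {x : M2} (hx : x ∈ grading d) :
    rho * x ∈ grading (d + (-1, -1)) := by
  rcases eq_of_mem_grading hx with rfl | ⟨a, b, rfl, rfl⟩ | ⟨j, k, rfl, rfl⟩
  · rw [mul_zero]; exact zero_mem _
  · rw [← mul_assoc, ← pow_succ']
    refine mem_grading_of_eq (monomial_mem_grading _ _) ?_
    ext <;> push_cast <;> simp <;> ring
  · rw [rho_mul_basisElt]
    split_ifs with h
    · obtain ⟨j, rfl⟩ := Nat.exists_eq_add_of_le' h
      refine mem_grading_of_eq (basisElt_mem_grading _ _) ?_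
      ext <;> push_cast <;> simp; ring
    · exact zero_mem _

theorem tau_mul_mem_grading {d : ℤ × ℤ} {x : M2} (hx : x ∈ grading d) :
    tau * x ∈ grading (d + (0, -1)) := by
  rcases eq_of_mem_grading hx with rfl | ⟨a, b, rfl, rfl⟩ | ⟨j, k, rfl, rfl⟩
  · rw [mul_zero]; exact zero_mem _
  · rw [mul_left_comm, ← pow_succ']
    refine mem_grading_of_eq (monomial_mem_grading _ _) ?_
    ext <;> push_cast <;> simp; ring
  · rw [tau_mul_basisElt]
    split_ifs with h
    · obtain ⟨k, rfl⟩ := Nat.exists_eq_add_of_le' h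
      refine mem_grading_of_eq (basisElt_mem_grading _ _) ?_
      ext <;> push_cast <;> simp; ring
    · exact zero_mem _

theorem monomial_mul_mem_grading (a b : ℕ) {d : ℤ × ℤ} {x : M2} (hx : x ∈ grading d) :
    rho ^ a * tau ^ b * x ∈ grading ((-(a : ℤ), -(a : ℤ) - b) + d) := by
  induction a with
  | zero =>
    induction b with
    | zero =>
      refine mem_grading_of_eq (d := d) (by simpa using hx) ?_
      ext <;> simp
    | succ b ih =>
      rw [pow_succ', mul_left_comm, mul_assoc]
      refine mem_grading_of_eq (tau_mul_mem_grading ih) ?_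
      ext <;> push_cast <;> simp; ring
  | succ a ih =>
    rw [pow_succ', mul_assoc, mul_assoc, ← mul_assoc (rho ^ a)]
    refine mem_grading_of_eq (rho_mul_mem_grading ih) ?_
    ext <;> push_cast <;> simp <;> ring

theorem mul_mem_grading {d e : ℤ × ℤ} {x y : M2} (hx : x ∈ grading d) (hy : y ∈ grading e) :
    x * y ∈ grading (d + e) := by
  rcases eq_of_mem_grading hx with rfl | ⟨a, b, rfl, rfl⟩ | ⟨j, k, rfl, rfl⟩
  · rw [zero_mul]; exact zero_mem _
  · exact monomial_mul_mem_grading a b hy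
  · rcases eq_of_mem_grading hy with rfl | ⟨a, b, rfl, rfl⟩ | ⟨j', k', rfl, rfl⟩
    · rw [mul_zero]; exact zero_mem _
    · rw [mul_comm, add_comm]
      exact monomial_mul_mem_grading a b hx
    · rw [show mk 0 (NegCone.basisElt j k) * mk 0 (NegCone.basisElt j' k') = 0 from
        M2.ext (by simp) (by simp)]
      exact zero_mem _

theorem one_mem_grading : (1 : M2) ∈ grading 0 := by
  have h := monomial_mem_grading 0 0
  simp only [pow_zero, one_mul] at h
  exact mem_grading_of_eq h (by ext <;> simp)

theorem rho_mem_grading : rho ∈ grading (-1, -1) := by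
  have h := rho_mul_mem_grading one_mem_grading
  rwa [mul_one, zero_add] at h

theorem tau_mem_grading : tau ∈ grading (0, -1) := by
  have h := tau_mul_mem_grading one_mem_grading
  rwa [mul_one, zero_add] at h

theorem opQ0_mem_grading {d : ℤ × ℤ} {x : M2} (hx : x ∈ grading d) :
    opQ0 x ∈ grading (d + (-1, 0)) := by
  refine ⟨fun a b h => ?_, ?_⟩
  · simp only [opQ0, posC_mk, coeff_C_mul, hasseDeriv_coeff] at h
    rcases a with _ | a
    · simp at h
    · rw [coeff_X_mul, ← C_eq_natCast, coeff_C_mul] at h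
      rw [hx.1 a (b + 1) (right_ne_zero_of_mul h)]
      ext <;> push_cast <;> simp <;> ring
  · rcases eq_of_mem_grading hx with rfl | ⟨a, b, rfl, rfl⟩ | ⟨j, k, rfl, rfl⟩
    · simp [opQ0]
    · simp only [opQ0, negC_mk, negC_monomial, map_zero]
      exact fun _ _ h => absurd rfl h
    · intro j' k' h
      simp only [opQ0, negC_mk, negQ0, NegCone.lift_basisElt] at h
      split_ifs at h with hj
      · obtain ⟨j, rfl⟩ := Nat.exists_eq_add_of_le' hj
        rcases zero_or_eq_one ((k + 1 : ℕ) : ZMod 2) with hk | hk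
        · rw [hk, zero_smul] at h; exact absurd rfl h
        · rw [hk, one_smul, NegCone.coeff_basisElt] at h
          split_ifs at h with hjk
          · rw [← hjk.1, ← hjk.2]
            ext <;> push_cast <;> simp; ring
          · exact absurd rfl h
      · exact absurd rfl h

theorem opQ1_mem_grading {d : ℤ × ℤ} {x : M2} (hx : x ∈ grading d) :
    opQ1 x ∈ grading (d + (-3, -1)) := by
  refine ⟨fun a b h => ?_, ?_⟩
  · simp only [opQ1, posC_mk, ← C_pow, coeff_C_mul, hasseDeriv_coeff] at h
    rw [coeff_X_pow_mul'] at h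
    split_ifs at h with ha
    · obtain ⟨a, rfl⟩ := Nat.exists_eq_add_of_le' ha
      rw [Nat.add_sub_cancel, ← C_eq_natCast, coeff_C_mul] at h
      rw [hx.1 a (b + 2) (right_ne_zero_of_mul h)]
      ext <;> push_cast <;> simp <;> ring
    · exact absurd rfl h
  · rcases eq_of_mem_grading hx with rfl | ⟨a, b, rfl, rfl⟩ | ⟨j, k, rfl, rfl⟩
    · simp [opQ1]
    · simp only [opQ1, negC_mk, negC_monomial, map_zero]
      exact fun _ _ h => absurd rfl h
    · intro j' k' h
      simp only [opQ1, negC_mk, negQ1, NegCone.lift_basisElt] at h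
      split_ifs at h with hj
      · obtain ⟨j, rfl⟩ := Nat.exists_eq_add_of_le' hj
        rcases zero_or_eq_one ((k + 2).choose 2 : ZMod 2) with hk | hk
        · rw [hk, zero_smul] at h; exact absurd rfl h
        · rw [hk, one_smul, NegCone.coeff_basisElt] at h
          split_ifs at h with hjk
          · rw [← hjk.1, ← hjk.2]
            ext <;> push_cast <;> simp; ring
          · exact absurd rfl h
      · exact absurd rfl h

/-- The augmentation `M2 → 𝔽₂`, whose kernel is the ideal `(ρ, τ)`. -/
noncomputable def aug : M2 →+* ZMod 2 where
  toFun x := (x.posC.coeff 0).coeff 0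
  map_zero' := by simp
  map_one' := by simp
  map_add' x y := by simp
  map_mul' x y := by simp [mul_coeff_zero]

theorem aug_rho : aug rho = 0 := by
  change ((C X : PosCone).coeff 0).coeff 0 = 0
  simp

theorem aug_tau : aug tau = 0 := by
  change ((X : PosCone).coeff 0).coeff 0 = 0
  simp

theorem aug_opQ0 (x : M2) : aug (opQ0 x) = 0 := by
  change ((C X * hasseDeriv 1 x.posC : PosCone).coeff 0).coeff 0 = 0
  simp

theorem aug_opQ1 (x : M2) : aug (opQ1 x) = 0 := by
  change ((C X ^ 3 * hasseDeriv 2 x.posC : PosCone).coeff 0).coeff 0 = 0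
  rw [← C_pow, coeff_C_mul, mul_coeff_zero]
  simp

/-- The kernel of the augmentation is generated by `ρ` and `τ`. It contains the negative cone,
since every `γ / (ρ ^ j * τ ^ k)` is divisible by `ρ`. -/
theorem exists_of_aug_eq_zero {x : M2} (hx : aug x = 0) : ∃ u v, x = rho * u + tau * v := by
  have hn : ∀ n : NegCone, ∃ m : NegCone, (C X : PosCone) • m = n := fun n => by
    induction n using NegCone.induction_basisElt with
    | zero => exact ⟨0, smul_zero _⟩
    | add x y hx hy =>
      obtain ⟨a, rfl⟩ := hx
      obtain ⟨b, rfl⟩ := hy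
      exact ⟨a + b, smul_add _ _ _⟩
    | basis j k =>
      exact ⟨NegCone.basisElt (j + 1) k, by
        simp [rho_smul, NegCone.mulRho, NegCone.lift_basisElt]⟩
  obtain ⟨m, hm⟩ := hn x.negC
  have hp : (x.posC.coeff 0).coeff 0 = 0 := hx
  refine ⟨mk (C (divX (x.posC.coeff 0))) m, mk (divX x.posC) 0, ?_⟩
  ext1
  · have h1 := divX_mul_X_add x.posC
    have h2 := divX_mul_X_add (x.posC.coeff 0)
    rw [hp, C_0, add_zero] at h2
    simp only [rho, tau, posC_add, posC_mul, posC_mk]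
    conv_lhs => rw [← h1, ← h2]
    rw [C_mul]
    ring
  · simp [rho, tau, hm]

theorem aug_eq_zero_of_mem_grading {d : ℤ × ℤ} (hd : d ≠ 0) {x : M2} (hx : x ∈ grading d) :
    aug x = 0 := by
  by_contra h
  exact hd ((hx.1 0 0 h).trans (by simp))

/-- The bigraded ring `M2` is local: a homogeneous element outside the ideal `(ρ, τ)` is not only
a unit but equal to `1`. -/
theorem eq_one_of_mem_grading {d : ℤ × ℤ} {x : M2} (hx : x ∈ grading d) (h : aug x ≠ 0) :
    x = 1 := by
  have hd : d = 0 := by_contra fun hd => h (aug_eq_zero_of_mem_grading hd hx)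
  subst hd
  rcases eq_of_mem_grading hx with rfl | ⟨a, b, hab, rfl⟩ | ⟨j, k, hjk, rfl⟩
  · simp at h
  · simp only [Prod.ext_iff, Prod.fst_zero, Prod.snd_zero] at hab
    rw [show a = 0 by omega, show b = 0 by omega, pow_zero, pow_zero, one_mul]
  · simp only [Prod.ext_iff, Prod.fst_zero, Prod.snd_zero] at hjk
    omega

end M2

/-! ### Homogeneous components -/

section Components

variable {A : Type*} [AddCommGroup A] {𝒜 : ℤ × ℤ → AddSubgroup A}
  {B : Type*} [AddCommGroup B] {ℬ : ℤ × ℤ → AddSubgroup B}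

/-- The projection of a bigraded group onto its homogeneous component of degree `d`. -/
noncomputable def comp (h : DirectSum.IsInternal 𝒜) (d : ℤ × ℤ) : A →+ A :=
  (𝒜 d).subtype.comp ((DFinsupp.evalAddMonoidHom d).comp
    (AddEquiv.ofBijective (DirectSum.coeAddMonoidHom 𝒜) h).symm.toAddMonoidHom)

theorem comp_mem (h : DirectSum.IsInternal 𝒜) (d : ℤ × ℤ) (x : A) : comp h d x ∈ 𝒜 d :=
  SetLike.coe_mem _

theorem comp_of_mem (h : DirectSum.IsInternal 𝒜) {d : ℤ × ℤ} {x : A} (hx : x ∈ 𝒜 d)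
    (e : ℤ × ℤ) : comp h e x = if d = e then x else 0 := by
  have h1 : (AddEquiv.ofBijective (DirectSum.coeAddMonoidHom 𝒜) h).symm x =
      DirectSum.of (fun d => 𝒜 d) d ⟨x, hx⟩ := by
    rw [AddEquiv.symm_apply_eq]
    exact (DirectSum.coeAddMonoidHom_of 𝒜 d ⟨x, hx⟩).symm
  change (((AddEquiv.ofBijective (DirectSum.coeAddMonoidHom 𝒜) h).symm x e : 𝒜 e) : A) = _
  rw [h1, DirectSum.coe_of_apply]
  split_ifs <;> rfl

theorem comp_of_mem_self (h : DirectSum.IsInternal 𝒜) {d : ℤ × ℤ} {x : A} (hx : x ∈ 𝒜 d) :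
    comp h d x = x := by rw [comp_of_mem h hx, if_pos rfl]

theorem iSup_grading (h : DirectSum.IsInternal 𝒜) : ⨆ d, 𝒜 d = ⊤ := by
  rw [eq_top_iff]
  intro x _
  obtain ⟨z, rfl⟩ := h.2 x
  induction z using DirectSum.induction_on with
  | zero => rw [map_zero]; exact zero_mem _
  | of d y =>
    rw [DirectSum.coeAddMonoidHom_of]
    exact AddSubgroup.mem_iSup_of_mem d y.2
  | add y z hy hz => rw [map_add]; exact add_mem (hy trivial) (hz trivial)

/-- Induction on homogeneous elements. -/
theorem homogeneous_induction (h : DirectSum.IsInternal 𝒜) {p : A → Prop} (x : A)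
    (zero : p 0) (add : ∀ x y, p x → p y → p (x + y)) (mem : ∀ d, ∀ x ∈ 𝒜 d, p x) : p x :=
  AddSubgroup.iSup_induction 𝒜 (C := p) (by rw [iSup_grading h]; trivial) mem zero add

/-- Projections onto homogeneous components commute with homogeneous maps. -/
theorem map_comp_of_homogeneous (hA : DirectSum.IsInternal 𝒜) (hB : DirectSum.IsInternal ℬ)
    (φ : A →+ B) (e : ℤ × ℤ) (hφ : ∀ d, ∀ x ∈ 𝒜 d, φ x ∈ ℬ (d + e)) (d : ℤ × ℤ) (x : A) :
    φ (comp hA d x) = comp hB (d + e) (φ x) := by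
  induction x using homogeneous_induction hA with
  | zero => simp
  | add x y hx hy => simp only [map_add, hx, hy]
  | mem d' x hx =>
    rw [comp_of_mem hA hx, comp_of_mem hB (hφ d' x hx)]
    by_cases h : d' = d
    · rw [if_pos h, if_pos (by rw [h])]
    · rw [if_neg h, if_neg (fun h' => h (add_right_cancel h')), map_zero]

/-- An element all of whose homogeneous components lie in a subgroup lies in that subgroup. -/
theorem mem_of_comp_mem (h : DirectSum.IsInternal 𝒜) (S : AddSubgroup A) {x : A}
    (hx : ∀ d, comp h d x ∈ S) : x ∈ S := by
  classical
  have hx' : x = DirectSum.coeAddMonoidHom 𝒜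
      ((AddEquiv.ofBijective (DirectSum.coeAddMonoidHom 𝒜) h).symm x) :=
    ((AddEquiv.ofBijective (DirectSum.coeAddMonoidHom 𝒜) h).apply_symm_apply x).symm
  rw [hx', DirectSum.coeAddMonoidHom_eq_dfinsuppSum]
  exact sum_mem fun d _ => hx d

/-- A criterion for a family of subgroups to be a grading: there are enough additive maps, each
of which vanishes on all but one of the subgroups, to separate elements. -/
theorem isInternal_of_separating {T : Type*} {F : Type*} [AddCommGroup F] (φ : T → A →+ F)
    (deg : T → ℤ × ℤ) (hdeg : ∀ d, ∀ x ∈ 𝒜 d, ∀ t, φ t x ≠ 0 → deg t = d)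
    (hsep : ∀ x, (∀ t, φ t x = 0) → x = 0) (hspan : ∀ x, x ∈ ⨆ d, 𝒜 d) :
    DirectSum.IsInternal 𝒜 := by
  classical
  constructor
  · rw [injective_iff_map_eq_zero]
    intro z hz
    refine DFinsupp.ext fun d => Subtype.ext (hsep _ fun t => ?_)
    by_contra ht
    have hd : deg t = d := hdeg d _ (z d).2 t ht
    rw [DirectSum.coeAddMonoidHom_eq_dfinsuppSum] at hz
    have h1 := congrArg (φ t) hz
    rw [DFinsupp.sum, map_sum, map_zero, Finset.sum_eq_single d] at h1
    · exact ht h1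
    · intro e _ hed
      by_contra h'
      exact hed ((hdeg e _ (z e).2 t h').symm.trans hd)
    · intro hd'
      rw [DFinsupp.notMem_support_iff.1 hd']
      simp
  · intro x
    refine AddSubgroup.iSup_induction 𝒜 (C := fun x => ∃ z, DirectSum.coeAddMonoidHom 𝒜 z = x)
      (hspan x) (fun d x hx => ⟨DirectSum.of (fun d => 𝒜 d) d ⟨x, hx⟩, ?_⟩) ⟨0, map_zero _⟩ ?_
    · exact DirectSum.coeAddMonoidHom_of 𝒜 d ⟨x, hx⟩
    · rintro _ _ ⟨y, rfl⟩ ⟨z, rfl⟩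
      exact ⟨y + z, map_add _ _ _⟩

theorem isInternal_prod (hA : DirectSum.IsInternal 𝒜) (hB : DirectSum.IsInternal ℬ) :
    DirectSum.IsInternal (fun d => (𝒜 d).prod (ℬ d)) := by
  refine isInternal_of_separating (fun d => (comp hA d).prodMap (comp hB d)) id ?_ ?_ ?_
  · rintro d ⟨x, y⟩ ⟨hx, hy⟩ e h
    by_contra hd
    refine h (Prod.ext ?_ ?_)
    · exact (comp_of_mem hA hx e).trans (if_neg (Ne.symm hd))
    · exact (comp_of_mem hB hy e).trans (if_neg (Ne.symm hd))
  · rintro ⟨x, y⟩ h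
    exact Prod.ext (mem_of_comp_mem hA ⊥ fun d => congrArg Prod.fst (h d))
      (mem_of_comp_mem hB ⊥ fun d => congrArg Prod.snd (h d))
  · rintro ⟨x, y⟩
    rw [show (x, y) = (x, 0) + (0, y) by simp]
    refine add_mem ?_ ?_
    · induction x using homogeneous_induction hA with
      | zero => exact zero_mem _
      | add x y hx hy => rw [show (x + y, (0 : B)) = (x, 0) + (y, 0) by simp]; exact add_mem hx hy
      | mem d x hx => exact AddSubgroup.mem_iSup_of_mem d ⟨hx, zero_mem _⟩
    · induction y using homogeneous_induction hB with
      | zero => exact zero_mem _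
      | add x y hx hy => rw [show ((0 : A), x + y) = (0, x) + (0, y) by simp]; exact add_mem hx hy
      | mem d x hx => exact AddSubgroup.mem_iSup_of_mem d ⟨zero_mem _, hx⟩

/-- A finite product of shifted copies of a bigraded group. -/
def piGrading (𝒜 : ℤ × ℤ → AddSubgroup A) {J : Type*} (δ : J → ℤ × ℤ) (d : ℤ × ℤ) :
    AddSubgroup (J → A) :=
  AddSubgroup.pi Set.univ fun j => 𝒜 (d - δ j)

theorem mem_piGrading {J : Type*} {δ : J → ℤ × ℤ} {d : ℤ × ℤ} {x : J → A} :
    x ∈ piGrading 𝒜 δ d ↔ ∀ j, x j ∈ 𝒜 (d - δ j) := by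
  simp [piGrading, AddSubgroup.mem_pi]

theorem isInternal_piGrading (h : DirectSum.IsInternal 𝒜) {J : Type*} [Finite J]
    (δ : J → ℤ × ℤ) : DirectSum.IsInternal (piGrading 𝒜 δ) := by
  classical
  cases nonempty_fintype J
  refine isInternal_of_separating
    (fun d => AddMonoidHom.pi fun j => (comp h (d - δ j)).comp (Pi.evalAddMonoidHom _ j)) id
    ?_ ?_ ?_
  · intro d x hx e he
    by_contra hd
    refine he (funext fun j => ?_)
    exact (comp_of_mem h (mem_piGrading.1 hx j) _).trans
      (if_neg fun h' => hd (sub_left_injective h').symm)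
  · intro x hx
    refine funext fun j => mem_of_comp_mem h ⊥ fun d => ?_
    have := congrFun (hx (d + δ j)) j
    change comp h (d + δ j - δ j) (x j) = 0 at this
    rwa [add_sub_cancel_right] at this
  · intro x
    rw [← Finset.univ_sum_single x]
    refine sum_mem fun j _ => ?_
    generalize x j = y
    induction y using homogeneous_induction h with
    | zero => simp
    | add x y hx hy => rw [Pi.single_add]; exact add_mem hx hy
    | mem d y hy =>
      refine AddSubgroup.mem_iSup_of_mem (d + δ j) (mem_piGrading.2 fun i => ?_)
      by_cases hi : i = j
      · subst hi; simpa using hy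
      · rw [Pi.single_eq_of_ne hi]; exact zero_mem _

end Components

namespace M2

theorem isInternal_grading : DirectSum.IsInternal grading := by
  refine isInternal_of_separating (T := (ℕ × ℕ) ⊕ (ℕ × ℕ)) (F := ZMod 2)
    (Sum.elim (fun p => ⟨⟨fun x => (x.posC.coeff p.2).coeff p.1, by simp⟩, by simp⟩)
      fun p => ⟨⟨fun x => x.negC.coeff p.1 p.2, rfl⟩, fun _ _ => rfl⟩)
    (Sum.elim (fun p => (-(p.1 : ℤ), -(p.1 : ℤ) - p.2))
      fun p => ((p.1 : ℤ), 1 + p.1 + ((p.2 + 1 : ℕ) : ℤ))) ?_ ?_ ?_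
  · rintro d x hx (p | p) h
    · exact (hx.1 _ _ h).symm
    · exact (hx.2 _ _ h).symm
  · intro x h
    exact M2.ext (Polynomial.ext fun b => Polynomial.ext fun a => h (Sum.inl (a, b)))
      (NegCone.ext_coeff fun j k => h (Sum.inr (j, k)))
  · intro x
    have hx : x = mk x.posC 0 + mk 0 x.negC := by ext1 <;> simp
    rw [hx]
    refine add_mem ?_ ?_
    · have key : ∀ (c : ZMod 2) (a b : ℕ), mk (C (C c * X ^ a) * X ^ b) 0 ∈ ⨆ d, grading d := by
        intro c a b
        rcases zero_or_eq_one c with rfl | rfl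
        · rw [C_0, zero_mul, C_0, zero_mul]; exact zero_mem _
        · rw [C_1, one_mul, ← posC_monomial]
          refine AddSubgroup.mem_iSup_of_mem (-(a : ℤ), -(a : ℤ) - b) ?_
          rw [show mk (rho ^ a * tau ^ b).posC 0 = rho ^ a * tau ^ b from
            M2.ext rfl (negC_monomial a b).symm]
          exact monomial_mem_grading a b
      have hadd : ∀ p q : PosCone, mk (p + q) 0 = mk p 0 + mk q 0 := fun p q => by
        ext1 <;> simp
      have key2 : ∀ (p : Polynomial (ZMod 2)) (b : ℕ), mk (C p * X ^ b) 0 ∈ ⨆ d, grading d := by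
        intro p b
        induction p using Polynomial.induction_on' with
        | add p q hp hq => rw [C_add, add_mul, hadd]; exact add_mem hp hq
        | monomial n c => rw [← C_mul_X_pow_eq_monomial]; exact key c n b
      induction x.posC using Polynomial.induction_on' with
      | add p q hp hq => rw [hadd]; exact add_mem hp hq
      | monomial n c => rw [← C_mul_X_pow_eq_monomial]; exact key2 c n
    · induction x.negC using NegCone.induction_basisElt with
      | zero => exact zero_mem _
      | add x y hx hy =>
        rw [show mk 0 (x + y) = mk 0 x + mk 0 y by ext1 <;> simp]
        exact add_mem hx hy
      | basis j k => exact AddSubgroup.mem_iSup_of_mem _ (basisElt_mem_grading j k)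

end M2

namespace E1

theorem smul_mem_grading {d e : ℤ × ℤ} {r : M2} {x : E1} (hr : r ∈ M2.grading d)
    (hx : x ∈ grading e) : r • x ∈ grading (d + e) := by
  refine ⟨M2.mul_mem_grading hr hx.1, ?_, ?_, ?_⟩ <;> rw [add_assoc]
  · exact M2.mul_mem_grading hr hx.2.1
  · exact M2.mul_mem_grading hr hx.2.2.1
  · exact M2.mul_mem_grading hr hx.2.2.2

theorem leftQ0_mem_grading {d : ℤ × ℤ} {x : E1} (hx : x ∈ grading d) :
    leftQ0 x ∈ grading (d + (-1, 0)) := by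
  obtain ⟨d1, d2⟩ := d
  obtain ⟨h0, h1, h2, h3⟩ := hx
  refine ⟨M2.opQ0_mem_grading h0, add_mem (M2.mem_grading_of_eq h0 ?_)
    (M2.mem_grading_of_eq (M2.opQ0_mem_grading h1) ?_), M2.mem_grading_of_eq
    (M2.opQ0_mem_grading h2) ?_, add_mem (M2.mem_grading_of_eq h2 ?_)
    (M2.mem_grading_of_eq (M2.opQ0_mem_grading h3) ?_)⟩ <;>
  ext <;> simp <;> ring_nf

theorem leftQ1_mem_grading {d : ℤ × ℤ} {x : E1} (hx : x ∈ grading d) :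
    leftQ1 x ∈ grading (d + (-3, -1)) := by
  obtain ⟨d1, d2⟩ := d
  obtain ⟨h0, h1, h2, h3⟩ := hx
  refine ⟨M2.opQ1_mem_grading h0, add_mem (M2.mem_grading_of_eq (M2.mul_mem_grading
      M2.rho_mem_grading (M2.opQ0_mem_grading h0)) ?_)
    (M2.mem_grading_of_eq (M2.opQ1_mem_grading h1) ?_), add_mem (M2.mem_grading_of_eq h0 ?_)
    (M2.mem_grading_of_eq (M2.opQ1_mem_grading h2) ?_), add_mem (add_mem
      (M2.mem_grading_of_eq h1 ?_) (M2.mem_grading_of_eq (M2.mul_mem_grading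
      M2.rho_mem_grading (M2.opQ0_mem_grading h2)) ?_))
    (M2.mem_grading_of_eq (M2.opQ1_mem_grading h3) ?_)⟩ <;>
  simp only [Prod.mk_add_mk, Prod.mk.injEq] <;> omega

theorem mem_grading_of_eq {d e : ℤ × ℤ} {x : E1} (hx : x ∈ grading d) (h : d = e) :
    x ∈ grading e := h ▸ hx

theorem mul_mem_grading {d e : ℤ × ℤ} {x y : E1} (hx : x ∈ grading d) (hy : y ∈ grading e) :
    x * y ∈ grading (d + e) := by
  obtain ⟨h0, h1, h2, h3⟩ := hx
  rw [mul_def]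
  refine add_mem (add_mem (add_mem (smul_mem_grading h0 hy) ?_) ?_) ?_
  · refine mem_grading_of_eq (smul_mem_grading h1 (leftQ0_mem_grading hy)) ?_
    ext <;> simp; ring
  · refine mem_grading_of_eq (smul_mem_grading h2 (leftQ1_mem_grading hy)) ?_
    ext <;> simp <;> ring
  · refine mem_grading_of_eq (smul_mem_grading h3 (leftQ0_mem_grading (leftQ1_mem_grading hy))) ?_
    ext <;> simp <;> ring

theorem ofM2_mem_grading {d : ℤ × ℤ} {r : M2} (hr : r ∈ M2.grading d) : ofM2 r ∈ grading d :=
  ⟨hr, zero_mem _, zero_mem _, zero_mem _⟩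

theorem one_mem_grading : (1 : E1) ∈ grading 0 := ofM2_mem_grading M2.one_mem_grading

theorem Q_zero_mem_grading : Q 0 ∈ grading (-1, 0) :=
  ⟨zero_mem _, M2.mem_grading_of_eq M2.one_mem_grading (by ext <;> simp), zero_mem _, zero_mem _⟩

theorem Q_one_mem_grading : Q 1 ∈ grading (-3, -1) :=
  ⟨zero_mem _, zero_mem _, M2.mem_grading_of_eq M2.one_mem_grading (by ext <;> simp), zero_mem _⟩

theorem isInternal_grading : DirectSum.IsInternal grading := by
  have h := M2.isInternal_grading
  refine isInternal_of_separating (T := ℤ × ℤ) (F := M2 × M2 × M2 × M2)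
    (fun d => ⟨⟨fun x => (comp h d x.c0, comp h (d + (1, 0)) x.c1, comp h (d + (3, 1)) x.c2,
      comp h (d + (4, 1)) x.c3), by simp⟩, by simp⟩) id ?_ ?_ ?_
  · rintro d x ⟨h0, h1, h2, h3⟩ e he
    by_contra hd
    replace hd : ¬ d = e := fun h => hd h.symm
    refine he ?_
    simp [comp_of_mem h h0, comp_of_mem h h1, comp_of_mem h h2, comp_of_mem h h3, hd]
  · intro x hx
    simp only [AddMonoidHom.coe_mk, ZeroHom.coe_mk, Prod.mk_eq_zero] at hx
    refine E1.ext (mem_of_comp_mem h ⊥ fun d => (hx d).1) (mem_of_comp_mem h ⊥ fun d => ?_)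
      (mem_of_comp_mem h ⊥ fun d => ?_) (mem_of_comp_mem h ⊥ fun d => ?_)
    · have := (hx (d - (1, 0))).2.1
      rwa [sub_add_cancel] at this
    · have := (hx (d - (3, 1))).2.2.1
      rwa [sub_add_cancel] at this
    · have := (hx (d - (4, 1))).2.2.2
      rwa [sub_add_cancel] at this
  · have key : ∀ (x : M2) (φ : M2 →+ E1) (e : ℤ × ℤ),
        (∀ d, ∀ r ∈ M2.grading d, φ r ∈ grading (d - e)) → φ x ∈ ⨆ d, grading d := by
      intro x φ e hφ
      induction x using homogeneous_induction h with
      | zero => rw [map_zero]; exact zero_mem _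
      | add x y hx hy => rw [map_add]; exact add_mem hx hy
      | mem d x hx => exact AddSubgroup.mem_iSup_of_mem _ (hφ d x hx)
    rintro ⟨a, b, c, d⟩
    have h0 := key a ⟨⟨fun r => ⟨r, 0, 0, 0⟩, rfl⟩, fun r s => by ext1 <;> simp⟩ 0
      (fun d r hr => ⟨by simpa using hr, zero_mem _, zero_mem _, zero_mem _⟩)
    have h1 := key b ⟨⟨fun r => ⟨0, r, 0, 0⟩, rfl⟩, fun r s => by ext1 <;> simp⟩ (1, 0)
      (fun d r hr => ⟨zero_mem _, by simpa using hr, zero_mem _, zero_mem _⟩)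
    have h2 := key c ⟨⟨fun r => ⟨0, 0, r, 0⟩, rfl⟩, fun r s => by ext1 <;> simp⟩ (3, 1)
      (fun d r hr => ⟨zero_mem _, zero_mem _, by simpa using hr, zero_mem _⟩)
    have h3 := key d ⟨⟨fun r => ⟨0, 0, 0, r⟩, rfl⟩, fun r s => by ext1 <;> simp⟩ (4, 1)
      (fun d r hr => ⟨zero_mem _, zero_mem _, zero_mem _, by simpa using hr⟩)
    have := add_mem (add_mem (add_mem h0 h1) h2) h3
    convert this using 1
    ext1 <;> simp

end E1

/-! ### Reduction modulo `(ρ, τ)` and Margolis homology -/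

namespace E1

@[simp] theorem ofM2_c0 (r : M2) : (ofM2 r).c0 = r := rfl
@[simp] theorem ofM2_c1 (r : M2) : (ofM2 r).c1 = 0 := rfl
@[simp] theorem ofM2_c2 (r : M2) : (ofM2 r).c2 = 0 := rfl
@[simp] theorem ofM2_c3 (r : M2) : (ofM2 r).c3 = 0 := rfl

theorem ofM2_mul (r : M2) (x : E1) : ofM2 r * x = r • x := by
  rw [mul_def]
  ext1 <;> simp

theorem Q_zero_mul (x : E1) : Q 0 * x = leftQ0 x := by
  rw [mul_def]
  ext1 <;> simp [Q]

theorem Q_one_mul (x : E1) : Q 1 * x = leftQ1 x := by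
  rw [mul_def]
  ext1 <;> simp [Q]

theorem Q_mul_comm : Q 0 * Q 1 = Q 1 * Q 0 := by
  have h := leftQ0_leftQ1 1
  rwa [← Q_one_mul, ← Q_zero_mul, mul_one, ← Q_zero_mul, ← Q_one_mul, mul_one] at h

theorem Q_zero_mul_ofM2 (r : M2) : Q 0 * ofM2 r = ofM2 r * Q 0 + ofM2 (M2.opQ0 r) := by
  rw [Q_zero_mul, ofM2_mul]
  ext1 <;> simp [leftQ0, Q, M2.opQ0_zero]

theorem Q_one_mul_ofM2 (r : M2) :
    Q 1 * ofM2 r = ofM2 r * Q 1 + ofM2 (M2.rho * M2.opQ0 r) * Q 0 + ofM2 (M2.opQ1 r) := by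
  rw [Q_one_mul, ofM2_mul, ofM2_mul]
  ext1 <;> simp [leftQ1, Q, M2.opQ0_zero, M2.opQ1_zero]

theorem Q_zero_mul_Q_one : Q 0 * Q 1 = ⟨0, 0, 0, 1⟩ := by
  rw [Q_zero_mul]
  ext1 <;> simp [leftQ0, Q, M2.opQ0_zero, M2.opQ0_one]

theorem eq_sum (x : E1) : x = ofM2 x.c0 + ofM2 x.c1 * Q 0 + ofM2 x.c2 * Q 1 +
    ofM2 x.c3 * (Q 0 * Q 1) := by
  rw [ofM2_mul, ofM2_mul, ofM2_mul, Q_zero_mul_Q_one]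
  ext1 <;> simp [Q]

theorem mem_rhoTau_iff {x : E1} : x ∈ rhoTau E1 ↔
    M2.aug x.c0 = 0 ∧ M2.aug x.c1 = 0 ∧ M2.aug x.c2 = 0 ∧ M2.aug x.c3 = 0 := by
  constructor
  · rintro ⟨y, z, rfl⟩
    simp [smul_eq_mul, ofM2_mul, M2.aug_rho, M2.aug_tau]
  · rintro ⟨h0, h1, h2, h3⟩
    obtain ⟨u0, v0, h0⟩ := M2.exists_of_aug_eq_zero h0
    obtain ⟨u1, v1, h1⟩ := M2.exists_of_aug_eq_zero h1
    obtain ⟨u2, v2, h2⟩ := M2.exists_of_aug_eq_zero h2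
    obtain ⟨u3, v3, h3⟩ := M2.exists_of_aug_eq_zero h3
    refine ⟨⟨u0, u1, u2, u3⟩, ⟨v0, v1, v2, v3⟩, ?_⟩
    rw [smul_eq_mul, smul_eq_mul, ofM2_mul, ofM2_mul]
    exact E1.ext h0 h1 h2 h3

end E1

section

variable {M N : Type u} [AddCommGroup M] [Module E1 M] [AddCommGroup N] [Module E1 N]

open E1 (Q ofM2)

theorem ofM2_smul_mem_rhoTau {r : M2} (hr : M2.aug r = 0) (x : M) : ofM2 r • x ∈ rhoTau M := by
  obtain ⟨u, v, rfl⟩ := M2.exists_of_aug_eq_zero hr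
  exact ⟨ofM2 u • x, ofM2 v • x, by rw [map_add, add_smul, map_mul, map_mul, mul_smul, mul_smul]⟩

theorem map_mem_rhoTau {M : Type*} {N : Type*} [AddCommGroup M] [Module E1 M] [AddCommGroup N]
    [Module E1 N] (f : M →ₗ[E1] N) {x : M} (hx : x ∈ rhoTau M) : f x ∈ rhoTau N := by
  obtain ⟨y, z, rfl⟩ := hx
  exact ⟨f y, f z, by simp⟩

theorem smul_mem_rhoTau_of_mem {a : E1} (ha : a ∈ rhoTau E1) (x : M) : a • x ∈ rhoTau M :=
  map_mem_rhoTau (LinearMap.toSpanSingleton E1 M x) ha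

/-- The quotient by the submodule `S` has zero Margolis homology with respect to `Q₀` and `Q₁`. -/
def IsAcyclicMod (S : Submodule E1 M) : Prop :=
  ∀ (i : Fin 2) (x : M), Q i • x ∈ S → ∃ z, x - Q i • z ∈ S

theorem isAcyclicMod_rhoTau_E1 : IsAcyclicMod (rhoTau E1) := by
  intro i x hx
  rw [E1.mem_rhoTau_iff] at hx
  fin_cases i
  · refine ⟨⟨x.c1, 0, x.c3, 0⟩, E1.mem_rhoTau_iff.2 ?_⟩
    simp only [Fin.zero_eta, smul_eq_mul, E1.Q_zero_mul, E1.leftQ0, map_add, M2.aug_opQ0,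
      add_zero] at hx
    simp [sub_eq_add_neg, E1.Q_zero_mul, E1.leftQ0, M2.aug_opQ0, M2.opQ0_zero, hx]
  · refine ⟨⟨x.c2, x.c3, 0, 0⟩, E1.mem_rhoTau_iff.2 ?_⟩
    simp only [Fin.mk_one, smul_eq_mul, E1.Q_one_mul, E1.leftQ1, map_add, map_mul, M2.aug_opQ1,
      M2.aug_rho, zero_mul, add_zero] at hx
    simp [sub_eq_add_neg, E1.Q_one_mul, E1.leftQ1, M2.aug_opQ1, M2.aug_rho, M2.opQ0_zero,
      M2.opQ1_zero, hx]

/-- Free modules over `E1` have zero Margolis homology modulo `(ρ, τ)`. -/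
theorem isAcyclicMod_rhoTau_of_basis {ι : Type*} (b : Module.Basis ι E1 M) :
    IsAcyclicMod (rhoTau M) := by
  intro i x hx
  have h : ∀ k, ∃ z, b.repr x k - Q i • z ∈ rhoTau E1 := fun k => by
    refine isAcyclicMod_rhoTau_E1 i _ ?_
    have := map_mem_rhoTau (b.coord k) hx
    rwa [map_smul, Module.Basis.coord_apply] at this
  choose z hz using h
  refine ⟨∑ k ∈ (b.repr x).support, z k • b k, ?_⟩
  have hx' : x = ∑ k ∈ (b.repr x).support, b.repr x k • b k := (b.linearCombination_repr x).symm
  have h : (∑ k ∈ (b.repr x).support, b.repr x k • b k) -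
      Q i • ∑ k ∈ (b.repr x).support, z k • b k ∈ rhoTau M := by
    rw [Finset.smul_sum, ← Finset.sum_sub_distrib]
    refine sum_mem fun k _ => ?_
    rw [← mul_smul, ← sub_smul]
    exact smul_mem_rhoTau_of_mem (hz k) _
  rwa [← hx'] at h

/-- Elementwise form of the condition that a map induces an isomorphism on Margolis homology
modulo `(ρ, τ)`. -/
theorem bijective_mapMargolis_iff (q : E1) (f : M →ₗ[E1] N) :
    Function.Bijective (mapMargolis q (mapModRhoTau f)) ↔
      (∀ x, q • x ∈ rhoTau M → (∃ z, f x - q • z ∈ rhoTau N) → ∃ z, x - q • z ∈ rhoTau M) ∧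
      ∀ y, q • y ∈ rhoTau N → ∃ x, q • x ∈ rhoTau M ∧ ∃ z, y - f x - q • z ∈ rhoTau N := by
  have hzero : ∀ {L : Type u} [AddCommGroup L] [Module E1 L] (x : L)
      (hx : q • (Submodule.Quotient.mk x : ModRhoTau L) = 0),
      ((QuotientAddGroup.mk ⟨Submodule.Quotient.mk x, hx⟩ : MargolisHomology q (ModRhoTau L)) = 0 ↔
        ∃ z, x - q • z ∈ rhoTau L) := by
    intro L _ _ x hx
    rw [QuotientAddGroup.eq_zero_iff]
    constructor
    · rintro ⟨y, hy⟩
      obtain ⟨z, rfl⟩ := Submodule.Quotient.mk_surjective _ y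
      refine ⟨z, (Submodule.Quotient.eq _).1 ?_⟩
      exact hy.symm
    · rintro ⟨z, hz⟩
      exact ⟨Submodule.Quotient.mk z, ((Submodule.Quotient.eq _).2 hz).symm⟩
  have hker : ∀ {L : Type u} [AddCommGroup L] [Module E1 L] (x : L),
      q • (Submodule.Quotient.mk x : ModRhoTau L) = 0 ↔ q • x ∈ rhoTau L := by
    intro L _ _ x
    rw [← Submodule.Quotient.mk_smul, Submodule.Quotient.mk_eq_zero]
  have hmap : ∀ (x : M) (hx : q • (Submodule.Quotient.mk x : ModRhoTau M) = 0),
      ∃ hfx, mapMargolis q (mapModRhoTau f) (QuotientAddGroup.mk ⟨Submodule.Quotient.mk x, hx⟩) =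
        QuotientAddGroup.mk ⟨Submodule.Quotient.mk (f x), hfx⟩ := by
    intro x hx
    refine ⟨?_, rfl⟩
    change q • (Submodule.Quotient.mk (f x) : ModRhoTau N) = 0
    rw [hker, ← map_smul]
    exact map_mem_rhoTau f ((hker x).1 hx)
  refine and_congr ?_ ?_
  · rw [injective_iff_map_eq_zero]
    constructor
    · intro h x hx hfx
      obtain ⟨hfx', he⟩ := hmap x ((hker x).2 hx)
      exact (hzero x ((hker x).2 hx)).1 (h _ (he.trans ((hzero (f x) hfx').2 hfx)))
    · intro h a ha
      obtain ⟨⟨x, hx⟩, rfl⟩ := QuotientAddGroup.mk_surjective a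
      obtain ⟨x, rfl⟩ := Submodule.Quotient.mk_surjective _ x
      obtain ⟨hfx', he⟩ := hmap x hx
      rw [he] at ha
      exact (hzero x hx).2 (h x ((hker x).1 hx) ((hzero (f x) hfx').1 ha))
  · constructor
    · intro h y hy
      obtain ⟨a, ha⟩ := h (QuotientAddGroup.mk ⟨Submodule.Quotient.mk y, (hker y).2 hy⟩)
      obtain ⟨⟨x, hx⟩, rfl⟩ := QuotientAddGroup.mk_surjective a
      obtain ⟨x, rfl⟩ := Submodule.Quotient.mk_surjective _ x
      obtain ⟨hfx', he⟩ := hmap x hx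
      refine ⟨x, (hker x).1 hx, ?_⟩
      rw [he, ← sub_eq_zero, ← neg_eq_zero, neg_sub] at ha
      rw [← hzero (y - f x) (by
        rw [hker, smul_sub]
        exact sub_mem hy ((hker _).1 hfx'))]
      exact ha
    · intro h a
      obtain ⟨⟨y, hy⟩, rfl⟩ := QuotientAddGroup.mk_surjective a
      obtain ⟨y, rfl⟩ := Submodule.Quotient.mk_surjective _ y
      obtain ⟨x, hx, hz⟩ := h y ((hker y).1 hy)
      obtain ⟨hfx', he⟩ := hmap x ((hker x).2 hx)
      refine ⟨QuotientAddGroup.mk ⟨Submodule.Quotient.mk x, (hker x).2 hx⟩, ?_⟩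
      rw [he, eq_comm, ← sub_eq_zero]
      exact (hzero (y - f x) (by
        rw [hker, smul_sub]
        exact sub_mem ((hker _).1 hy) ((hker _).1 hfx'))).2 hz

theorem mem_rhoTau_prod_iff {x : M × N} :
    x ∈ rhoTau (M × N) ↔ x.1 ∈ rhoTau M ∧ x.2 ∈ rhoTau N := by
  constructor
  · intro h
    exact ⟨map_mem_rhoTau (LinearMap.fst E1 M N) h, map_mem_rhoTau (LinearMap.snd E1 M N) h⟩
  · rintro ⟨⟨y, z, h⟩, ⟨y', z', h'⟩⟩
    exact ⟨(y, y'), (z, z'), Prod.ext h h'⟩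

/-- Free summands have zero Margolis homology, so a stable equivalence induces isomorphisms. -/
theorem bijective_mapMargolis_of_isStableEquiv {ℳ : ℤ × ℤ → AddSubgroup M}
    {𝒩 : ℤ × ℤ → AddSubgroup N} {f : M →ₗ[E1] N} (h : IsStableEquiv ℳ 𝒩 f) (i : Fin 2) :
    Function.Bijective (mapMargolis (Q i) (mapModRhoTau f)) := by
  obtain ⟨P, R, _, _, _, _, gP, gR, g, -, ⟨ιP, bP, -⟩, -, ⟨ιR, bR, -⟩, -, hg⟩ := h
  have hP := isAcyclicMod_rhoTau_of_basis bP i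
  have hR := isAcyclicMod_rhoTau_of_basis bR i
  rw [bijective_mapMargolis_iff]
  constructor
  · rintro x hx ⟨z, hz⟩
    have h1 : Q i • (g (x, 0)).2 ∈ rhoTau R := by
      have : Q i • (x, (0 : P)) ∈ rhoTau (M × P) :=
        mem_rhoTau_prod_iff.2 ⟨hx, by simp [zero_mem]⟩
      have := map_mem_rhoTau g.toLinearMap this
      rw [map_smul] at this
      exact (mem_rhoTau_prod_iff.1 this).2
    obtain ⟨w, hw⟩ := hR _ h1
    have h2 : g (x, 0) - Q i • (z, w) ∈ rhoTau (N × R) :=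
      mem_rhoTau_prod_iff.2 ⟨by simpa [hg] using hz, hw⟩
    have h3 := map_mem_rhoTau g.symm.toLinearMap h2
    rw [map_sub, map_smul] at h3
    simp only [LinearEquiv.coe_coe, LinearEquiv.symm_apply_apply] at h3
    exact ⟨_, (mem_rhoTau_prod_iff.1 h3).1⟩
  · intro y hy
    obtain ⟨⟨x, p⟩, hxp⟩ := g.surjective (y, 0)
    have h1 : Q i • (x, p) ∈ rhoTau (M × P) := by
      have : Q i • (y, (0 : R)) ∈ rhoTau (N × R) :=
        mem_rhoTau_prod_iff.2 ⟨hy, by simp [zero_mem]⟩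
      have := map_mem_rhoTau g.symm.toLinearMap this
      rw [map_smul, ← hxp] at this
      simpa using this
    obtain ⟨w, hw⟩ := hP p (mem_rhoTau_prod_iff.1 h1).2
    refine ⟨x, (mem_rhoTau_prod_iff.1 h1).1, (g (0, w)).1, ?_⟩
    have h2 : ((0 : M), p) - Q i • ((0 : M), w) ∈ rhoTau (M × P) :=
      mem_rhoTau_prod_iff.2 ⟨by simp [zero_mem], hw⟩
    have h3 := map_mem_rhoTau g.toLinearMap h2
    rw [map_sub, map_smul] at h3
    have h4 := (mem_rhoTau_prod_iff.1 h3).1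
    have h5 : (g (0, p)).1 = y - f x := by
      rw [← hg x, eq_sub_iff_add_eq, ← Prod.fst_add, ← map_add]
      simp [hxp]
    rw [← h5]
    exact h4

end

/-! ### Homogeneous bases over `M2` -/

section

open E1 (Q ofM2)

variable {B : Type u} [AddCommGroup B] [Module E1 B] {ℬ : ℤ × ℤ → AddSubgroup B}

/-- The finite family `b` of homogeneous elements of degrees `β` is a basis over `M2`, where `M2`
acts through its inclusion into `E1`. -/
structure IsM2Basis {I : Type*} [Fintype I] (ℬ : ℤ × ℤ → AddSubgroup B) (b : I → B)
    (β : I → ℤ × ℤ) : Prop where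
  mem : ∀ i, b i ∈ ℬ (β i)
  bijective : Function.Bijective fun a : I → M2 => ∑ i, ofM2 (a i) • b i

instance : Nontrivial M2 := M2.aug.domain_nontrivial

instance : Module.Finite M2 E1 := by
  refine ⟨Submodule.fg_def.2 ⟨{1, Q 0, Q 1, Q 0 * Q 1}, Set.toFinite _,
    eq_top_iff.2 fun x _ => ?_⟩⟩
  rw [E1.eq_sum x, ← mul_one (ofM2 x.c0)]
  simp only [E1.ofM2_mul]
  refine add_mem (add_mem (add_mem ?_ ?_) ?_) ?_ <;>
    exact Submodule.smul_mem _ _ (Submodule.subset_span (by simp))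

theorem exists_isM2Basis (hfin : Module.Finite E1 B) (hfree : IsGradedM2Free ℬ) :
    ∃ (I : Type u) (_ : Fintype I) (b : I → B) (β : I → ℤ × ℤ), IsM2Basis ℬ b β := by
  let _ : Module M2 B := Module.compHom B E1.ofM2
  obtain ⟨I, b, hb⟩ := hfree
  have : IsScalarTower M2 E1 B := ⟨fun r x y => by
    rw [← E1.ofM2_mul, mul_smul]
    rfl⟩
  have : Module.Finite M2 B := Module.Finite.trans E1 B
  have : Finite I := Module.Finite.finite_basis b
  cases nonempty_fintype I
  choose β hβ using hb
  refine ⟨I, inferInstance, b, β, hβ, ?_⟩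
  have h := b.equivFun.symm.bijective
  convert h using 1
  ext a
  exact (b.equivFun_symm_apply a).symm

namespace IsM2Basis

variable {I : Type*} [Fintype I] {b : I → B} {β : I → ℤ × ℤ}

/-- The coordinates of an element with respect to a basis over `M2`. -/
noncomputable def coord (hb : IsM2Basis ℬ b β) : B ≃+ (I → M2) :=
  (AddEquiv.ofBijective (AddMonoidHom.mk' (fun a : I → M2 => ∑ i, ofM2 (a i) • b i)
    fun x y => by simp [add_smul, Finset.sum_add_distrib]) hb.bijective).symm

theorem coord_symm (hb : IsM2Basis ℬ b β) (a : I → M2) :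
    hb.coord.symm a = ∑ i, ofM2 (a i) • b i := rfl

theorem sum_coord (hb : IsM2Basis ℬ b β) (x : B) : ∑ i, ofM2 (hb.coord x i) • b i = x :=
  hb.coord.symm_apply_apply x

theorem coord_sum (hb : IsM2Basis ℬ b β) (a : I → M2) :
    hb.coord (∑ i, ofM2 (a i) • b i) = a :=
  hb.coord.apply_symm_apply a

theorem coord_smul (hb : IsM2Basis ℬ b β) (r : M2) (x : B) :
    hb.coord (ofM2 r • x) = r • hb.coord x := by
  rw [← hb.coord_sum (r • hb.coord x)]
  congr 1
  simp only [Pi.smul_apply, smul_eq_mul, map_mul, mul_smul, ← Finset.smul_sum, sum_coord]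

theorem coord_mem_grading (hb : IsM2Basis ℬ b β) (hB : IsGraded ℬ) {d : ℤ × ℤ} {x : B}
    (hx : x ∈ ℬ d) (i : I) : hb.coord x i ∈ M2.grading (d - β i) := by
  have h : hb.coord x = fun i => comp M2.isInternal_grading (d - β i) (hb.coord x i) := by
    refine hb.coord.symm.injective ?_
    rw [AddEquiv.symm_apply_apply, coord_symm]
    conv_lhs => rw [← comp_of_mem_self hB.isInternal hx, ← hb.sum_coord x, map_sum]
    refine Finset.sum_congr rfl fun i _ => ?_
    have h1 := map_comp_of_homogeneous M2.isInternal_grading hB.isInternal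
      (AddMonoidHom.mk' (fun r => ofM2 r • b i) fun r s => by rw [map_add, add_smul]) (β i)
      (fun e r hr => hB.smul_mem e _ _ _ (E1.ofM2_mem_grading hr) (hb.mem i))
      (d - β i) (hb.coord x i)
    rw [sub_add_cancel] at h1
    exact h1.symm
  rw [h]
  exact comp_mem _ _ _

theorem mem_rhoTau_iff (hb : IsM2Basis ℬ b β) {x : B} :
    x ∈ rhoTau B ↔ ∀ i, M2.aug (hb.coord x i) = 0 := by
  constructor
  · rintro ⟨y, z, rfl⟩ i
    simp [coord_smul, M2.aug_rho, M2.aug_tau]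
  · intro h
    rw [← hb.sum_coord x]
    exact sum_mem fun i _ => ofM2_smul_mem_rhoTau (h i) _

/-- A homogeneous element whose degree is not the degree of a basis element is zero modulo
`(ρ, τ)`. -/
theorem mem_rhoTau_of_mem (hb : IsM2Basis ℬ b β) (hB : IsGraded ℬ) {d : ℤ × ℤ} {x : B}
    (hx : x ∈ ℬ d) (hd : ∀ i, d ≠ β i) : x ∈ rhoTau B :=
  hb.mem_rhoTau_iff.2 fun i => M2.aug_eq_zero_of_mem_grading (sub_ne_zero.2 (hd i))
    (hb.coord_mem_grading hB hx i)

end IsM2Basis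

/-! ### Nakayama's lemma -/

theorem M2.prod_mem_grading {I : Type*} (s : Finset I) (x : I → M2) (d : I → ℤ × ℤ)
    (h : ∀ i ∈ s, x i ∈ M2.grading (d i)) : ∏ i ∈ s, x i ∈ M2.grading (∑ i ∈ s, d i) := by
  classical
  induction s using Finset.induction_on with
  | empty => simpa using M2.one_mem_grading
  | insert i s hi ih =>
    rw [Finset.prod_insert hi, Finset.sum_insert hi]
    exact M2.mul_mem_grading (h i (Finset.mem_insert_self i s))
      (ih fun j hj => h j (Finset.mem_insert_of_mem hj))

/-- The determinant of a homogeneous matrix is homogeneous. -/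
theorem M2.det_mem_grading {I : Type*} [Fintype I] [DecidableEq I] (X : Matrix I I M2)
    (α β : I → ℤ × ℤ) (h : ∀ i j, X i j ∈ M2.grading (α j - β i)) :
    X.det ∈ M2.grading (∑ i, α i - ∑ i, β i) := by
  rw [Matrix.det_apply]
  refine sum_mem fun σ _ => ?_
  rw [Units.smul_def]
  refine zsmul_mem ?_ _
  rw [← Equiv.sum_comp σ β, ← Finset.sum_sub_distrib]
  exact M2.prod_mem_grading _ _ _ fun i _ => h _ _

theorem M2.aug_surjective : Function.Surjective M2.aug := by
  intro c
  rcases M2.zero_or_eq_one c with rfl | rfl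
  exacts [⟨0, map_zero _⟩, ⟨1, map_one _⟩]

/-- **Nakayama's lemma** for finite graded free modules: a degree-preserving map that is an
isomorphism modulo `(ρ, τ)` is an isomorphism. -/
theorem bijective_of_bijective_mod_rhoTau {A : Type u} [AddCommGroup A] [Module E1 A]
    {𝒜 : ℤ × ℤ → AddSubgroup A} {I J : Type*} [Fintype I] [Fintype J] {a : I → A}
    {α : I → ℤ × ℤ} {b : J → B} {β : J → ℤ × ℤ} (ha : IsM2Basis 𝒜 a α) (hb : IsM2Basis ℬ b β)
    (hB : IsGraded ℬ) (h : A →ₗ[E1] B) (hdeg : PreservesDegree 𝒜 ℬ h)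
    (hinj : ∀ x, h x ∈ rhoTau B → x ∈ rhoTau A) (hsurj : ∀ y, ∃ x, y - h x ∈ rhoTau B) :
    Function.Bijective h := by
  classical
  let X : Matrix J I M2 := Matrix.of fun j i => hb.coord (h (a i)) j
  have hX : ∀ v : I → M2, hb.coord (h (ha.coord.symm v)) = X.mulVec v := by
    intro v
    rw [ha.coord_symm, map_sum, map_sum]
    ext1 j
    simp only [map_smul, IsM2Basis.coord_smul, Finset.sum_apply, Matrix.mulVec, dotProduct, X,
      Matrix.of_apply, Pi.smul_apply, smul_eq_mul]
    exact Finset.sum_congr rfl fun i _ => mul_comm _ _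
  have haug : ∀ v : I → M2, (X.map M2.aug).mulVec (M2.aug ∘ v) = M2.aug ∘ X.mulVec v := by
    intro v
    ext1 j
    exact (RingHom.map_mulVec M2.aug X v j).symm
  have hbij : Function.Bijective (X.map M2.aug).mulVecLin := by
    constructor
    · rw [← LinearMap.ker_eq_bot, LinearMap.ker_eq_bot']
      intro m hm
      obtain ⟨v, rfl⟩ : ∃ v : I → M2, M2.aug ∘ v = m :=
        ⟨fun i => (M2.aug_surjective (m i)).choose,
          funext fun i => (M2.aug_surjective (m i)).choose_spec⟩
      rw [Matrix.mulVecLin_apply, haug, ← hX] at hm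
      have h1 := ha.mem_rhoTau_iff.1 (hinj _ (hb.mem_rhoTau_iff.2 fun j => congrFun hm j))
      rw [AddEquiv.apply_symm_apply] at h1
      exact funext h1
    · intro m
      obtain ⟨v, rfl⟩ : ∃ v : J → M2, M2.aug ∘ v = m :=
        ⟨fun i => (M2.aug_surjective (m i)).choose,
          funext fun i => (M2.aug_surjective (m i)).choose_spec⟩
      obtain ⟨x, hx⟩ := hsurj (hb.coord.symm v)
      refine ⟨M2.aug ∘ ha.coord x, ?_⟩
      rw [Matrix.mulVecLin_apply, haug, ← hX, AddEquiv.symm_apply_apply]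
      refine funext fun j => ?_
      have h1 := hb.mem_rhoTau_iff.1 hx j
      rw [map_sub, AddEquiv.apply_symm_apply, Pi.sub_apply, map_sub, sub_eq_zero] at h1
      exact h1.symm
  have hcard : Fintype.card I = Fintype.card J := by
    have := (LinearEquiv.ofBijective _ hbij).finrank_eq
    simpa using this
  let e : I ≃ J := Fintype.equivOfCardEq hcard
  let Y : Matrix I I M2 := X.submatrix e id
  have hY : ∀ v, Y.mulVec v = X.mulVec v ∘ e := fun v => rfl
  have hYaug : ∀ v, (Y.map M2.aug).mulVec v = (X.map M2.aug).mulVec v ∘ e := fun v => rfl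
  have hdet : M2.aug Y.det ≠ 0 := by
    rw [RingHom.map_det, RingHom.mapMatrix_apply, ← isUnit_iff_ne_zero,
      ← Matrix.isUnit_iff_isUnit_det, ← Matrix.mulVec_injective_iff_isUnit]
    intro v w hvw
    simp only [hYaug] at hvw
    exact hbij.1 (e.surjective.injective_comp_right hvw)
  -- The determinant is homogeneous and nonzero modulo `(ρ, τ)`, so it is equal to `1`.
  have hdet1 : Y.det = 1 := M2.eq_one_of_mem_grading
    (M2.det_mem_grading Y α (fun i => β (e i)) fun i j =>
      hb.coord_mem_grading hB (hdeg _ _ (ha.mem j)) (e i)) hdet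
  have hYbij : Function.Bijective Y.mulVec := by
    have hu : IsUnit Y.det := hdet1 ▸ isUnit_one
    refine Function.bijective_iff_has_inverse.2 ⟨Y⁻¹.mulVec, fun v => ?_, fun v => ?_⟩
    · rw [Matrix.mulVec_mulVec, Matrix.nonsing_inv_mul _ hu, Matrix.one_mulVec]
    · rw [Matrix.mulVec_mulVec, Matrix.mul_nonsing_inv _ hu, Matrix.one_mulVec]
  have hXbij : Function.Bijective X.mulVec := by
    have he : Function.Bijective fun v : J → M2 => v ∘ e :=
      (Equiv.arrowCongr e.symm (Equiv.refl M2)).bijective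
    exact (he.of_comp_iff' X.mulVec).1 hYbij
  have hfun : ⇑h = hb.coord.symm ∘ X.mulVec ∘ ha.coord := by
    ext x
    rw [Function.comp_apply, Function.comp_apply, ← hX, AddEquiv.symm_apply_apply,
      AddEquiv.symm_apply_apply]
  rw [hfun]
  exact hb.coord.symm.bijective.comp (hXbij.comp ha.coord.bijective)

end

/-! ### Free modules over `E1` and coinduction -/

section

open E1 (Q ofM2)

variable {M B N : Type u} [AddCommGroup M] [Module E1 M] [AddCommGroup B] [Module E1 B]
  [AddCommGroup N] [Module E1 N]

/-- The basis `1, Q₀, Q₁, Q₀ Q₁` of `E1` over `M2`. -/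
noncomputable def E1.milnorBasis : Fin 4 → E1 := ![1, Q 0, Q 1, Q 0 * Q 1]

/-- The bidegrees of `1, Q₀, Q₁, Q₀ Q₁`. -/
def E1.milnorDegree : Fin 4 → ℤ × ℤ := ![0, (-1, 0), (-3, -1), (-4, -1)]

theorem E1.milnorBasis_mem_grading (k : Fin 4) :
    E1.milnorBasis k ∈ E1.grading (E1.milnorDegree k) := by
  fin_cases k
  · exact E1.one_mem_grading
  · exact E1.Q_zero_mem_grading
  · exact E1.Q_one_mem_grading
  · exact E1.mul_mem_grading E1.Q_zero_mem_grading E1.Q_one_mem_grading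

theorem E1.sum_milnorBasis (a : Fin 4 → M2) :
    ∑ k, ofM2 (a k) * E1.milnorBasis k = ⟨a 0, a 1, a 2, a 3⟩ := by
  rw [Fin.sum_univ_four]
  simp only [E1.milnorBasis, Matrix.cons_val, mul_one]
  exact (E1.eq_sum ⟨a 0, a 1, a 2, a 3⟩).symm

/-- A finite direct sum of shifts of `E1` is a bigraded module. -/
theorem isGraded_piGrading {J : Type*} [Finite J] (δ : J → ℤ × ℤ) :
    IsGraded (piGrading E1.grading δ) where
  isInternal := isInternal_piGrading E1.isInternal_grading δ
  smul_mem d e a x ha hx := mem_piGrading.2 fun j => by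
    rw [add_sub_assoc]
    exact E1.mul_mem_grading ha (mem_piGrading.1 hx j)

theorem single_mem_piGrading {J : Type*} [DecidableEq J] (δ : J → ℤ × ℤ) (j : J) {d : ℤ × ℤ}
    {x : E1} (hx : x ∈ E1.grading d) :
    (Pi.single j x : J → E1) ∈ piGrading E1.grading δ (δ j + d) := by
  refine mem_piGrading.2 fun i => ?_
  by_cases hi : i = j
  · subst hi
    rwa [Pi.single_eq_same, add_sub_cancel_left]
  · rw [Pi.single_eq_of_ne hi]
    exact zero_mem _

theorem isGradedFree_piGrading {J : Type u} [Finite J] (δ : J → ℤ × ℤ) :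
    IsGradedFree (piGrading E1.grading δ) := by
  classical
  refine ⟨J, Pi.basisFun E1 J, fun j => ⟨δ j + 0, ?_⟩⟩
  rw [Pi.basisFun_apply]
  exact single_mem_piGrading δ j E1.one_mem_grading

theorem IsGraded.prod {ℳ : ℤ × ℤ → AddSubgroup M} {𝒩 : ℤ × ℤ → AddSubgroup N} (hM : IsGraded ℳ)
    (hN : IsGraded 𝒩) : IsGraded (fun d => (ℳ d).prod (𝒩 d)) where
  isInternal := isInternal_prod hM.isInternal hN.isInternal
  smul_mem d e a x ha hx := ⟨hM.smul_mem d e a x.1 ha hx.1, hN.smul_mem d e a x.2 ha hx.2⟩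

/-- Adding free `E1`-modules to an `M2`-free module: the basis over `M2` is enlarged by the
multiples of the generators by `1, Q₀, Q₁, Q₀ Q₁`. -/
theorem IsM2Basis.prod_piGrading {ℳ : ℤ × ℤ → AddSubgroup M} {I : Type*} [Fintype I] {b : I → M}
    {β : I → ℤ × ℤ} (hb : IsM2Basis ℳ b β) {J : Type*} [Fintype J] [DecidableEq J]
    (δ : J → ℤ × ℤ) :
    IsM2Basis (fun d => (ℳ d).prod (piGrading E1.grading δ d))
      (Sum.elim (fun i => (b i, (0 : J → E1)))
        fun p : J × Fin 4 => ((0 : M), (Pi.single p.1 (E1.milnorBasis p.2) : J → E1)))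
      (Sum.elim β fun p => δ p.1 + E1.milnorDegree p.2) := by
  constructor
  · rintro (i | p)
    · exact ⟨hb.mem i, zero_mem _⟩
    · exact ⟨zero_mem _, single_mem_piGrading δ p.1 (E1.milnorBasis_mem_grading p.2)⟩
  · have h : ∀ a : I ⊕ J × Fin 4 → M2, ∑ i, ofM2 (a i) • (Sum.elim (fun i => (b i, (0 : J → E1)))
        (fun p : J × Fin 4 => ((0 : M), (Pi.single p.1 (E1.milnorBasis p.2) : J → E1))) i) =
        (∑ i, ofM2 (a (Sum.inl i)) • b i, fun j => ⟨a (Sum.inr (j, 0)), a (Sum.inr (j, 1)),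
          a (Sum.inr (j, 2)), a (Sum.inr (j, 3))⟩) := by
      intro a
      rw [Fintype.sum_sum_type]
      simp only [Sum.elim_inl, Sum.elim_inr]
      refine Prod.ext ?_ (funext fun j => ?_)
      · simp [Prod.fst_sum]
      · rw [Prod.snd_add, Pi.add_apply, Prod.snd_sum, Prod.snd_sum, Finset.sum_apply,
          Finset.sum_apply]
        simp only [Prod.smul_snd, smul_zero, Pi.zero_apply, Finset.sum_const_zero, zero_add]
        rw [Fintype.sum_prod_type, Finset.sum_eq_single j]
        · simp only [Pi.smul_apply, Pi.single_eq_same, smul_eq_mul]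
          exact E1.sum_milnorBasis fun k => a (Sum.inr (j, k))
        · intro i _ hi
          refine Finset.sum_eq_zero fun k _ => ?_
          rw [Pi.smul_apply, Pi.single_eq_of_ne (Ne.symm hi), smul_zero]
        · exact fun hj => absurd (Finset.mem_univ j) hj
    simp only [h]
    constructor
    · intro a a' haa
      rw [Prod.mk.injEq] at haa
      have h1 := hb.bijective.1 haa.1
      refine funext fun i => ?_
      rcases i with i | ⟨j, k⟩
      · exact congrFun h1 i
      · have h2 := congrFun haa.2 j
        rw [E1.mk.injEq] at h2
        fin_cases k
        exacts [h2.1, h2.2.1, h2.2.2.1, h2.2.2.2]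
    · rintro ⟨x, y⟩
      obtain ⟨a, ha⟩ := hb.bijective.2 x
      exact ⟨Sum.elim a fun p => ![(y p.1).c0, (y p.1).c1, (y p.1).c2, (y p.1).c3] p.2,
        Prod.ext ha (funext fun j => rfl)⟩

theorem mem_rhoTau_pi_iff {J : Type*} {x : J → E1} :
    x ∈ rhoTau (J → E1) ↔ ∀ j, x j ∈ rhoTau E1 := by
  constructor
  · exact fun h j => map_mem_rhoTau (LinearMap.proj j) h
  · intro h
    choose y z hyz using h
    exact ⟨y, z, funext hyz⟩

theorem Q_zero_smul_ofM2_smul (r : M2) (x : M) :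
    Q 0 • ofM2 r • x = ofM2 r • Q 0 • x + ofM2 (M2.opQ0 r) • x := by
  rw [smul_smul, E1.Q_zero_mul_ofM2, add_smul, mul_smul]

theorem Q_one_smul_ofM2_smul (r : M2) (x : M) : Q 1 • ofM2 r • x = ofM2 r • Q 1 • x +
    ofM2 (M2.rho * M2.opQ0 r) • Q 0 • x + ofM2 (M2.opQ1 r) • x := by
  rw [smul_smul, E1.Q_one_mul_ofM2, add_smul, add_smul, mul_smul, mul_smul]

theorem Q_smul_comm (x : M) : Q 0 • Q 1 • x = Q 1 • Q 0 • x := by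
  rw [smul_smul, E1.Q_mul_comm, mul_smul]

theorem Q_smul_self (i : Fin 2) (x : M) : Q i • Q i • x = 0 := by
  rw [smul_smul, E1.Q_mul_self, zero_smul]

theorem map_smul_of_generators {A : Type*} [AddCommGroup A] [Module E1 A] (F : M →+ A)
    (h0 : ∀ x, F (Q 0 • x) = Q 0 • F x) (h1 : ∀ x, F (Q 1 • x) = Q 1 • F x)
    (hr : ∀ r x, F (ofM2 r • x) = ofM2 r • F x) (a : E1) (x : M) : F (a • x) = a • F x := by
  rw [E1.eq_sum a]
  simp only [add_smul, mul_smul, map_add, h0, h1, hr]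

/-- The element `Q₀ Q₁ p + Q₀ q + Q₁ s + t` of `E1`, with coefficients on the right. -/
noncomputable def E1.ofRight (p q s t : M2) : E1 :=
  E1.leftQ0 (E1.leftQ1 (ofM2 p)) + E1.leftQ0 (ofM2 q) + E1.leftQ1 (ofM2 s) + ofM2 t

theorem E1.ofRight_add (p q s t p' q' s' t' : M2) :
    E1.ofRight (p + p') (q + q') (s + s') (t + t') =
      E1.ofRight p q s t + E1.ofRight p' q' s' t' := by
  simp only [E1.ofRight, map_add, E1.leftQ0_add, E1.leftQ1_add]
  abel

theorem E1.Q_zero_mul_ofRight (p q s t : M2) :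
    Q 0 * E1.ofRight p q s t = E1.ofRight s t 0 0 := by
  rw [E1.Q_zero_mul]
  simp only [E1.ofRight, map_zero, E1.leftQ0_add, E1.leftQ0_leftQ0, E1.leftQ1_zero, zero_add,
    add_zero]

theorem E1.Q_one_mul_ofRight (p q s t : M2) :
    Q 1 * E1.ofRight p q s t = E1.ofRight q 0 t 0 := by
  rw [E1.Q_one_mul]
  simp only [E1.ofRight, map_zero, E1.leftQ1_add, ← E1.leftQ0_leftQ1, E1.leftQ1_leftQ1,
    E1.leftQ0_zero, zero_add, add_zero]

theorem E1.ofRight_c3 (p q s t : M2) : (E1.ofRight p q s t).c3 = p := by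
  simp [E1.ofRight, E1.leftQ0, E1.leftQ1, M2.opQ0_zero, M2.opQ1_zero]

/-- The commutation rules of `Q₀` and `Q₁` with `r`, used to move `r` to the right. -/
theorem E1.ofM2_mul_ofRight (r p q s t : M2) : ofM2 r * E1.ofRight p q s t =
    E1.ofRight (r * p) (r * q + M2.rho * M2.opQ0 r * s + M2.opQ1 r * p)
      (r * s + M2.opQ0 r * p)
      (r * t + M2.opQ0 r * q + M2.opQ1 r * s + M2.opQ0 (M2.opQ1 r) * p) := by
  rw [E1.ofM2_mul]
  ext1 <;> simp [-map_mul, -map_add, E1.ofRight, E1.leftQ0, E1.leftQ1, M2.opQ0_mul,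
      M2.opQ1_mul, M2.opQ0_add, M2.opQ1_add, M2.opQ0_opQ0, M2.opQ0_opQ1, M2.opQ0_rho,
      M2.opQ0_zero, M2.opQ1_zero] <;>
    ring_nf <;> simp only [E1.two_eq_zero, E1.four_eq_zero, mul_zero, add_zero]

/-- The algebra `E1` is a Frobenius extension of `M2`: an `M2`-linear functional `φ` on a module
extends to an `E1`-linear map `x ↦ Q₀ Q₁ φ(x) + Q₀ φ(Q₁ x) + Q₁ φ(Q₀ x) + φ(Q₀ Q₁ x)` to `E1`,
from which `φ` is recovered as the coefficient of `Q₀ Q₁`. -/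
noncomputable def coinduced (φ : M →+ M2) (hφ : ∀ r x, φ (ofM2 r • x) = r * φ x) :
    M →ₗ[E1] E1 where
  toFun x := E1.ofRight (φ x) (φ (Q 1 • x)) (φ (Q 0 • x)) (φ (Q 0 • Q 1 • x))
  map_add' x y := by
    simp only [smul_add, map_add, E1.ofRight_add]
  map_smul' a x := by
    let F : M →+ E1 := AddMonoidHom.mk'
      (fun x => E1.ofRight (φ x) (φ (Q 1 • x)) (φ (Q 0 • x)) (φ (Q 0 • Q 1 • x)))
      fun x y => by simp only [smul_add, map_add, E1.ofRight_add]
    have hF : ∀ x, F x = E1.ofRight (φ x) (φ (Q 1 • x)) (φ (Q 0 • x)) (φ (Q 0 • Q 1 • x)) :=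
      fun _ => rfl
    refine map_smul_of_generators F (fun x => ?_) (fun x => ?_) (fun r x => ?_) a x
    · rw [hF, hF, smul_eq_mul, E1.Q_zero_mul_ofRight, ← Q_smul_comm, Q_smul_self, Q_smul_self,
        map_zero]
    · rw [hF, hF, smul_eq_mul, E1.Q_one_mul_ofRight, Q_smul_self, smul_zero, map_zero]
    · rw [hF, hF, smul_eq_mul, E1.ofM2_mul_ofRight]
      simp only [Q_zero_smul_ofM2_smul, Q_one_smul_ofM2_smul, smul_add, map_add, hφ,
        Q_smul_self, map_zero]
      simp only [E1.opQ0_rho_mul, M2.opQ0_opQ0, mul_zero, zero_mul, add_zero, add_assoc]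

theorem coinduced_c3 (φ : M →+ M2) (hφ : ∀ r x, φ (ofM2 r • x) = r * φ x) (x : M) :
    (coinduced φ hφ x).c3 = φ x :=
  E1.ofRight_c3 _ _ _ _

theorem coinduced_mem_grading {ℳ : ℤ × ℤ → AddSubgroup M} (hM : IsGraded ℳ) (φ : M →+ M2)
    (hφ : ∀ r x, φ (ofM2 r • x) = r * φ x) (e : ℤ × ℤ)
    (hd : ∀ d, ∀ x ∈ ℳ d, φ x ∈ M2.grading (d - e)) {d : ℤ × ℤ} {x : M} (hx : x ∈ ℳ d) :
    coinduced φ hφ x ∈ E1.grading (d - (e + (4, 1))) := by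
  have h0 := hM.smul_mem _ _ _ _ E1.Q_zero_mem_grading hx
  have h1 := hM.smul_mem _ _ _ _ E1.Q_one_mem_grading hx
  have h01 := hM.smul_mem _ _ _ _ E1.Q_zero_mem_grading h1
  refine add_mem (add_mem (add_mem ?_ ?_) ?_) ?_
  · refine E1.mem_grading_of_eq (E1.leftQ0_mem_grading (E1.leftQ1_mem_grading
      (E1.ofM2_mem_grading (hd _ _ hx)))) ?_
    ext <;> simp <;> ring
  · refine E1.mem_grading_of_eq (E1.leftQ0_mem_grading (E1.ofM2_mem_grading (hd _ _ h1))) ?_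
    ext <;> simp <;> ring
  · refine E1.mem_grading_of_eq (E1.leftQ1_mem_grading (E1.ofM2_mem_grading (hd _ _ h0))) ?_
    ext <;> simp <;> ring
  · refine E1.mem_grading_of_eq (E1.ofM2_mem_grading (hd _ _ h01)) ?_
    ext <;> simp <;> ring

/-! ### Modules with zero Margolis homology -/

/-- In a bounded bigraded module with zero Margolis homology, an element killed by `Q₀ Q₁` is
in the sum of the images of `Q₀` and `Q₁`. For homogeneous `x`, write `Q₁ x = Q₀ x₁`; then `x₁` is
again killed by `Q₀ Q₁` and has smaller weight, so that one can induct. -/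
theorem exists_of_Q_smul_mem {ℬ : ℤ × ℤ → AddSubgroup B} (hB : IsGraded ℬ) (S : Submodule E1 B)
    (hhom : ∀ d, ∀ x ∈ S, comp hB.isInternal d x ∈ S) (hac : IsAcyclicMod S) (m : ℤ)
    (hm : ∀ d x, d.2 < m → x ∈ ℬ d → x ∈ S) (x : B) (hx : Q 0 • Q 1 • x ∈ S) :
    ∃ u v, x - Q 0 • u - Q 1 • v ∈ S := by
  have hcomp0 : ∀ d x, Q 0 • comp hB.isInternal d x = comp hB.isInternal (d + (-1, 0)) (Q 0 • x) :=
    map_comp_of_homogeneous hB.isInternal hB.isInternal (DistribSMul.toAddMonoidHom B (Q 0)) _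
      fun d x hx => by
        rw [add_comm]
        exact hB.smul_mem _ _ _ _ E1.Q_zero_mem_grading hx
  have hcomp1 : ∀ d x, Q 1 • comp hB.isInternal d x = comp hB.isInternal (d + (-3, -1)) (Q 1 • x) :=
    map_comp_of_homogeneous hB.isInternal hB.isInternal (DistribSMul.toAddMonoidHom B (Q 1)) _
      fun d x hx => by
        rw [add_comm]
        exact hB.smul_mem _ _ _ _ E1.Q_one_mem_grading hx
  have key : ∀ (n : ℕ) (d : ℤ × ℤ), d.2 < m + n → ∀ x ∈ ℬ d, Q 0 • Q 1 • x ∈ S →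
      ∃ u v, x - Q 0 • u - Q 1 • v ∈ S := by
    intro n
    induction n with
    | zero =>
      intro d hd x hx _
      exact ⟨0, 0, by simpa using hm d x (by simpa using hd) hx⟩
    | succ n ih =>
      intro d hd x hx hxS
      obtain ⟨z, hz⟩ := hac 0 (Q 1 • x) hxS
      let x₁ := comp hB.isInternal (d + (-2, -1)) z
      have hx₁ : Q 1 • x - Q 0 • x₁ ∈ S := by
        have h := hhom (d + (-3, -1)) _ hz
        rw [map_sub, ← hcomp1, comp_of_mem_self hB.isInternal hx] at h
        have h' : d + (-3, -1) = d + (-2, -1) + (-1, 0) := by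
          ext <;> simp; ring
        rwa [h', ← hcomp0] at h
      have hQx₁ : Q 0 • Q 1 • x₁ ∈ S := by
        have h := S.smul_mem (Q 1) hx₁
        rw [smul_sub, Q_smul_self, zero_sub, neg_mem_iff] at h
        rwa [Q_smul_comm]
      obtain ⟨u, v, huv⟩ := ih (d + (-2, -1)) (by push_cast at hd; simp; omega) x₁
        (comp_mem _ _ _) hQx₁
      have h1 : Q 1 • (x - Q 0 • v) ∈ S := by
        have h := S.add_mem hx₁ (S.smul_mem (Q 0) huv)
        rw [smul_sub, smul_sub, Q_smul_self] at h
        rw [smul_sub, ← Q_smul_comm]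
        convert h using 1
        abel
      obtain ⟨w, hw⟩ := hac 1 _ h1
      exact ⟨v, w, hw⟩
  let T : AddSubgroup B :=
    { carrier := {x | ∃ u v, x - Q 0 • u - Q 1 • v ∈ S}
      zero_mem' := ⟨0, 0, by simp⟩
      add_mem' := by
        rintro x y ⟨u, v, h⟩ ⟨u', v', h'⟩
        refine ⟨u + u', v + v', ?_⟩
        convert S.add_mem h h' using 1
        simp only [smul_add]
        abel
      neg_mem' := by
        rintro x ⟨u, v, h⟩
        refine ⟨-u, -v, ?_⟩
        convert S.neg_mem h using 1
        simp only [smul_neg]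
        abel }
  refine mem_of_comp_mem hB.isInternal T fun d => ?_
  refine key (d.2 - m + 1).toNat d (by omega) _ (comp_mem _ _ _) ?_
  rw [hcomp1, hcomp0]
  exact hhom _ _ hx

end

section

open E1 (Q ofM2)

variable {M B N : Type u} [AddCommGroup M] [Module E1 M] [AddCommGroup B] [Module E1 B]
  [AddCommGroup N] [Module E1 N]

theorem IsM2Basis.exists_forall_mem {ℬ : ℤ × ℤ → AddSubgroup B} {I : Type*} [Fintype I]
    {c : I → B} {β : I → ℤ × ℤ} (hc : IsM2Basis ℬ c β) (hB : IsGraded ℬ) :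
    ∃ m : ℤ, ∀ d x, d.2 < m → x ∈ ℬ d → x ∈ rhoTau B := by
  obtain ⟨m, hm⟩ := (Set.finite_range fun i => (β i).2).bddBelow
  refine ⟨m, fun d x hd hx => hc.mem_rhoTau_of_mem hB hx fun i hi => ?_⟩
  have := hm (Set.mem_range_self i)
  rw [hi] at hd
  exact absurd hd (not_lt.2 this)

/-- A quotient of a finite bigraded `M2`-free module by a homogeneous submodule containing
`(ρ, τ)` is, if its Margolis homology vanishes, free over the exterior algebra on `Q₀` and `Q₁`,
on the images of some elements of any given homogeneous basis over `M2`. -/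
theorem exists_free_generators {ℬ : ℤ × ℤ → AddSubgroup B} (hB : IsGraded ℬ) {I : Type u}
    [Fintype I] {c : I → B} {β : I → ℤ × ℤ} (hc : IsM2Basis ℬ c β) (S : Submodule E1 B)
    (hS : rhoTau B ≤ S) (hhom : ∀ d, ∀ x ∈ S, comp hB.isInternal d x ∈ S)
    (hac : IsAcyclicMod S) :
    ∃ (J : Type u) (_ : Fintype J) (a : J → I),
      (∀ x, ∃ e : J → E1, x - ∑ j, e j • c (a j) ∈ S) ∧
      ∀ e : J → E1, ∑ j, e j • c (a j) ∈ S → e ∈ rhoTau (J → E1) := by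
  obtain ⟨m, hm⟩ := hc.exists_forall_mem hB
  have hker := exists_of_Q_smul_mem hB S hhom hac m fun d x hd hx => hS (hm d x hd hx)
  let T : AddSubgroup B := S.toAddSubgroup ⊔ (DistribSMul.toAddMonoidHom B (Q 0)).range ⊔
    (DistribSMul.toAddMonoidHom B (Q 1)).range
  have hT : ∀ x, x ∈ T ↔ ∃ u v, x - Q 0 • u - Q 1 • v ∈ S := by
    intro x
    simp only [T, AddSubgroup.mem_sup]
    constructor
    · rintro ⟨_, ⟨s, hs, _, ⟨u, rfl⟩, rfl⟩, _, ⟨v, rfl⟩, rfl⟩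
      refine ⟨u, v, ?_⟩
      simp only [DistribSMul.toAddMonoidHom_apply]
      rwa [add_sub_right_comm, add_sub_cancel_right, add_sub_cancel_right]
    · rintro ⟨u, v, h⟩
      refine ⟨_, ⟨_, h, _, ⟨u, rfl⟩, rfl⟩, _, ⟨v, rfl⟩, ?_⟩
      simp only [DistribSMul.toAddMonoidHom_apply]
      abel
  have hST : ∀ x ∈ S, x ∈ T := fun x hx => (hT x).2 ⟨0, 0, by simpa using hx⟩
  let _ : Module (ZMod 2) (B ⧸ T) := QuotientAddGroup.zmodModule fun x => by
    rw [two_nsmul, ← one_smul E1 x, ← add_smul, E1.add_self, zero_smul]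
    exact zero_mem _
  have hsmul : ∀ (r : M2) (x : B), ((ofM2 r • x : B) : B ⧸ T) = M2.aug r • (x : B ⧸ T) := by
    intro r x
    rcases M2.zero_or_eq_one (M2.aug r) with h | h
    · rw [h, zero_smul, QuotientAddGroup.eq_zero_iff]
      exact hST _ (hS (ofM2_smul_mem_rhoTau h x))
    · rw [h, one_smul, ← sub_eq_zero, ← QuotientAddGroup.mk_sub, QuotientAddGroup.eq_zero_iff]
      have h' : M2.aug (r - 1) = 0 := by rw [map_sub, h, map_one, sub_self]
      have := hST _ (hS (ofM2_smul_mem_rhoTau h' x))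
      rwa [map_sub, map_one, sub_smul, one_smul] at this
  have hsum : ∀ {K : Type u} [Fintype K] (r : K → M2) (y : K → B),
      ((∑ k, ofM2 (r k) • y k : B) : B ⧸ T) = ∑ k, M2.aug (r k) • (y k : B ⧸ T) := by
    intro K _ r y
    rw [QuotientAddGroup.mk_sum]
    exact Finset.sum_congr rfl fun k _ => hsmul _ _
  obtain ⟨J, a, ha, hspan, hind⟩ :=
    exists_linearIndependent' (ZMod 2) fun i => (c i : B ⧸ T)
  have : Finite J := Finite.of_injective a ha
  cases nonempty_fintype J
  refine ⟨J, inferInstance, a, ?_, ?_⟩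
  · -- Since the elements `c (a j)` generate modulo the images of `Q₀` and `Q₁`, which are nilpotent
    -- and commute, they generate.
    let Y : Submodule E1 B := Submodule.span E1 (Set.range fun j => c (a j)) ⊔ S
    have hY : ∀ x, ∃ w ∈ Y, ∃ u v, x = w + Q 0 • u + Q 1 • v := by
      intro x
      have hx : (x : B ⧸ T) ∈
          Submodule.span (ZMod 2) (Set.range ((fun i => (c i : B ⧸ T)) ∘ a)) := by
        rw [hspan, Submodule.mem_span_range_iff_exists_fun]
        exact ⟨fun i => M2.aug (hc.coord x i), by rw [← hsum, hc.sum_coord]⟩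
      obtain ⟨n, hn⟩ := (Submodule.mem_span_range_iff_exists_fun _).1 hx
      choose r hr using fun j => M2.aug_surjective (n j)
      simp only [← hr, Function.comp_apply] at hn
      rw [← hsum, eq_comm, ← sub_eq_zero, ← QuotientAddGroup.mk_sub, QuotientAddGroup.eq_zero_iff,
        hT] at hn
      obtain ⟨u, v, huv⟩ := hn
      refine ⟨_, Y.add_mem (Submodule.mem_sup_left (sum_mem (t := Finset.univ)
        fun j _ => Submodule.smul_mem _ (ofM2 (r j))
          (Submodule.subset_span (Set.mem_range_self j)))) (Submodule.mem_sup_right huv), u, v, ?_⟩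
      abel
    have h01 : ∀ x, Q 0 • Q 1 • x ∈ Y := by
      intro x
      obtain ⟨w, hw, u, v, rfl⟩ := hY x
      rw [smul_add, smul_add, smul_add, smul_add, Q_smul_self, smul_zero, add_zero, ← Q_smul_comm,
        Q_smul_self, add_zero]
      exact Y.smul_mem _ (Y.smul_mem _ hw)
    have h0 : ∀ x, Q 0 • x ∈ Y := by
      intro x
      obtain ⟨w, hw, u, v, rfl⟩ := hY x
      rw [smul_add, smul_add, Q_smul_self, add_zero]
      exact Y.add_mem (Y.smul_mem _ hw) (h01 v)
    have h1 : ∀ x, Q 1 • x ∈ Y := by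
      intro x
      obtain ⟨w, hw, u, v, rfl⟩ := hY x
      rw [smul_add, smul_add, Q_smul_self, add_zero, ← Q_smul_comm]
      exact Y.add_mem (Y.smul_mem _ hw) (h01 u)
    intro x
    have hx : x ∈ Y := by
      obtain ⟨w, hw, u, v, rfl⟩ := hY x
      exact Y.add_mem (Y.add_mem hw (h0 u)) (h1 v)
    obtain ⟨w, hw, s, hs, rfl⟩ := Submodule.mem_sup.1 hx
    obtain ⟨e, rfl⟩ := (Submodule.mem_span_range_iff_exists_fun _).1 hw
    exact ⟨e, by rwa [add_sub_cancel_left]⟩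
  · -- The coefficient of `Q₀ Q₁` in a relation vanishes because `exists_of_Q_smul_mem` makes it a
    -- relation modulo the images of `Q₀` and `Q₁`. The other coefficients are moved to that place
    -- by multiplying the relation with `Q₀ Q₁`, `Q₁` and `Q₀`, in this order.
    have htop : ∀ e : J → E1, ∑ j, e j • c (a j) ∈ S →
        (∀ j, M2.aug (e j).c0 = 0 ∧ M2.aug (e j).c1 = 0 ∧ M2.aug (e j).c2 = 0) →
        ∀ j, M2.aug (e j).c3 = 0 := by
      intro e he h
      have h1 : Q 0 • Q 1 • ∑ j, ofM2 (e j).c3 • c (a j) ∈ S := by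
        have h2 : ∑ j, e j • c (a j) - Q 0 • Q 1 • ∑ j, ofM2 (e j).c3 • c (a j) ∈ S := by
          simp only [Finset.smul_sum]
          rw [← Finset.sum_sub_distrib]
          refine sum_mem fun j _ => hS ?_
          rw [smul_smul, smul_smul, ← sub_smul]
          refine smul_mem_rhoTau_of_mem (E1.mem_rhoTau_iff.2 ?_) _
          rw [mul_assoc, E1.Q_one_mul, E1.Q_zero_mul]
          simp [sub_eq_add_neg, E1.leftQ0, E1.leftQ1, M2.opQ0_zero, M2.opQ1_zero, M2.aug_opQ0,
            M2.aug_opQ1, h j]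
        have h3 := sub_mem he h2
        rwa [sub_sub_cancel] at h3
      have h4 := (hT _).2 (hker _ h1)
      rw [← QuotientAddGroup.eq_zero_iff, hsum] at h4
      exact Fintype.linearIndependent_iff.1 hind _ h4
    intro e he
    have hmul : ∀ q : E1, ∑ j, (q * e j) • c (a j) ∈ S := fun q => by
      have := S.smul_mem q he
      simpa only [Finset.smul_sum, smul_smul] using this
    have hc0 : ∀ j, M2.aug (e j).c0 = 0 := fun j => by
      have := htop (fun j => Q 0 * (Q 1 * e j)) (by
        simpa only [mul_assoc] using hmul (Q 0 * Q 1)) (fun j => by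
        simp [E1.Q_zero_mul, E1.Q_one_mul, E1.leftQ0, E1.leftQ1, M2.aug_opQ0, M2.aug_opQ1]) j
      simpa [E1.Q_zero_mul, E1.Q_one_mul, E1.leftQ0, E1.leftQ1, M2.aug_opQ0, M2.aug_opQ1] using this
    have hc1 : ∀ j, M2.aug (e j).c1 = 0 := fun j => by
      have := htop (fun j => Q 1 * e j) (hmul _) (fun j => by
        simp [E1.Q_one_mul, E1.leftQ1, M2.aug_opQ1, M2.aug_rho, hc0]) j
      simpa [E1.Q_one_mul, E1.leftQ1, M2.aug_opQ1, M2.aug_rho] using this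
    have hc2 : ∀ j, M2.aug (e j).c2 = 0 := fun j => by
      have := htop (fun j => Q 0 * e j) (hmul _) (fun j => by
        simp [E1.Q_zero_mul, E1.leftQ0, M2.aug_opQ0, hc0]) j
      simpa [E1.Q_zero_mul, E1.leftQ0, M2.aug_opQ0] using this
    have hc3 := htop e he fun j => ⟨hc0 j, hc1 j, hc2 j⟩
    exact mem_rhoTau_pi_iff.2 fun j => E1.mem_rhoTau_iff.2 ⟨hc0 j, hc1 j, hc2 j, hc3 j⟩

/-! ### The Whitehead theorem -/

/-- Embedding `M` into a free module, split over `M2`, makes `f` injective modulo `(ρ, τ)` without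
changing its stable class; the cokernel then has zero Margolis homology, so it is free modulo
`(ρ, τ)`, and lifts of its generators give the required isomorphism. -/
theorem isStableEquiv_of_bijective_mapMargolis {ℳ : ℤ × ℤ → AddSubgroup M}
    {𝒩 : ℤ × ℤ → AddSubgroup N} (hM : IsGraded ℳ) (hN : IsGraded 𝒩)
    (hMfin : Module.Finite E1 M) (hNfin : Module.Finite E1 N)
    (hMfree : IsGradedM2Free ℳ) (hNfree : IsGradedM2Free 𝒩)
    (f : M →ₗ[E1] N) (hf : PreservesDegree ℳ 𝒩 f)
    (h : ∀ i : Fin 2, Function.Bijective (mapMargolis (Q i) (mapModRhoTau f))) :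
    IsStableEquiv ℳ 𝒩 f := by
  classical
  obtain ⟨I, _, b, β, hb⟩ := exists_isM2Basis hMfin hMfree
  obtain ⟨K, _, c, γ, hc⟩ := exists_isM2Basis hNfin hNfree
  simp only [bijective_mapMargolis_iff] at h
  -- The map `g` embeds `M` into `N ⊕ E1 ^ I` and is split over `M2`: the coordinates of `x` are the
  -- coefficients of `Q₀ Q₁` in `Φ x`. It is injective modulo `(ρ, τ)`.
  let φ : I → M →+ M2 := fun i => (Pi.evalAddMonoidHom _ i).comp hb.coord.toAddMonoidHom
  have hφ : ∀ i r x, φ i (ofM2 r • x) = r * φ i x := fun i r x => congrFun (hb.coord_smul r x) i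
  let Φ : M →ₗ[E1] (I → E1) := LinearMap.pi fun i => coinduced (φ i) (hφ i)
  let g : M →ₗ[E1] N × (I → E1) := f.prod Φ
  let δ : I → ℤ × ℤ := fun i => β i + (4, 1)
  let ℬ : ℤ × ℤ → AddSubgroup (N × (I → E1)) := fun d => (𝒩 d).prod (piGrading E1.grading δ d)
  have hB : IsGraded ℬ := hN.prod (isGraded_piGrading δ)
  have hg : PreservesDegree ℳ ℬ g := fun d x hx => ⟨hf d x hx, mem_piGrading.2 fun i =>
    coinduced_mem_grading hM (φ i) (hφ i) (β i) (fun d x hx => hb.coord_mem_grading hM hx i) hx⟩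
  have hginj : ∀ x, g x ∈ rhoTau (N × (I → E1)) → x ∈ rhoTau M := by
    intro x hx
    refine hb.mem_rhoTau_iff.2 fun i => ?_
    have h1 := E1.mem_rhoTau_iff.1 (mem_rhoTau_pi_iff.1 (mem_rhoTau_prod_iff.1 hx).2 i)
    have h2 := h1.2.2.2
    rwa [show (g x).2 i = coinduced (φ i) (hφ i) x from rfl, coinduced_c3] at h2
  -- The quotient by the image of `g` has zero Margolis homology modulo `(ρ, τ)`.
  let S : Submodule E1 (N × (I → E1)) := rhoTau _ ⊔ LinearMap.range g
  have hmemS : ∀ y, y ∈ S ↔ ∃ x, y - g x ∈ rhoTau (N × (I → E1)) := by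
    intro y
    simp only [S, Submodule.mem_sup]
    constructor
    · rintro ⟨w, hw, _, ⟨x, rfl⟩, rfl⟩
      exact ⟨x, by rwa [add_sub_cancel_right]⟩
    · rintro ⟨x, hx⟩
      exact ⟨_, hx, _, ⟨x, rfl⟩, sub_add_cancel _ _⟩
  have hF : IsAcyclicMod (rhoTau (I → E1)) := isAcyclicMod_rhoTau_of_basis (Pi.basisFun E1 I)
  have hac : IsAcyclicMod S := by
    intro i y hy
    obtain ⟨x, hx⟩ := (hmemS _).1 hy
    have hQx : Q i • x ∈ rhoTau M := hginj _ (by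
      have := Submodule.smul_mem _ (Q i) hx
      rw [smul_sub, Q_smul_self, zero_sub, neg_mem_iff] at this
      rwa [map_smul])
    obtain ⟨w, hw⟩ := (h i).1 x hQx ⟨y.1, by
      have := neg_mem (mem_rhoTau_prod_iff.1 hx).1
      simpa [g] using this⟩
    have h1 : Q i • (y - g w) ∈ rhoTau (N × (I → E1)) := by
      have := add_mem hx (map_mem_rhoTau g hw)
      rw [map_sub, map_smul] at this
      rw [smul_sub]
      convert this using 1
      abel
    obtain ⟨x', hx', z, hz⟩ := (h i).2 _ (mem_rhoTau_prod_iff.1 h1).1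
    have h2 : Q i • (y - g w - g x') ∈ rhoTau (N × (I → E1)) := by
      rw [smul_sub, ← map_smul]
      exact sub_mem h1 (map_mem_rhoTau g hx')
    obtain ⟨z', hz'⟩ := hF i _ (mem_rhoTau_prod_iff.1 h2).2
    refine ⟨(z, z'), (hmemS _).2 ⟨w + x', ?_⟩⟩
    have h3 : y - g w - g x' - Q i • (z, z') ∈ rhoTau (N × (I → E1)) :=
      mem_rhoTau_prod_iff.2 ⟨hz, hz'⟩
    rw [map_add]
    convert h3 using 1
    abel
  have hhom : ∀ d, ∀ y ∈ S, comp hB.isInternal d y ∈ S := by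
    have hρ : ∀ (e : ℤ × ℤ) (r : M2), r ∈ M2.grading e → ∀ d y, ofM2 r • comp hB.isInternal d y =
        comp hB.isInternal (d + e) (ofM2 r • y) := fun e r hr =>
      map_comp_of_homogeneous hB.isInternal hB.isInternal
        (DistribSMul.toAddMonoidHom _ (ofM2 r)) e fun d x hx => by
          rw [add_comm]
          exact hB.smul_mem _ _ _ _ (E1.ofM2_mem_grading hr) hx
    intro d y hy
    obtain ⟨x, u, v, huv⟩ := (hmemS _).1 hy
    refine (hmemS _).2 ⟨comp hM.isInternal d x, comp hB.isInternal (d - (-1, -1)) u,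
      comp hB.isInternal (d - (0, -1)) v, ?_⟩
    have h1 := map_comp_of_homogeneous hM.isInternal hB.isInternal g.toAddMonoidHom 0
      (fun d x hx => by rw [add_zero]; exact hg d x hx) d x
    rw [add_zero] at h1
    rw [hρ _ _ M2.rho_mem_grading, hρ _ _ M2.tau_mem_grading, sub_add_cancel, sub_add_cancel,
      ← map_add, ← huv, map_sub]
    exact congrArg _ h1
  -- Free generators of that quotient complete `g` to an isomorphism.
  have hbB := hc.prod_piGrading δ
  obtain ⟨J, _, a, hgen, hind⟩ := exists_free_generators hB hbB S le_sup_left hhom hac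
  have hy := fun j => hbB.mem (a j)
  generalize hη : (fun j => Sum.elim γ (fun p : I × Fin 4 => δ p.1 + E1.milnorDegree p.2) (a j)) = η
  generalize hy' : (fun j => Sum.elim (fun k => (c k, (0 : I → E1)))
    (fun p : I × Fin 4 => ((0 : N), (Pi.single p.1 (E1.milnorBasis p.2) : I → E1))) (a j)) = y
  replace hy : ∀ j, y j ∈ ℬ (η j) := by
    subst hη hy'
    exact hy
  replace hgen : ∀ x, ∃ e : J → E1, x - ∑ j, e j • y j ∈ S := by
    subst hy'
    exact hgen
  replace hind : ∀ e : J → E1, ∑ j, e j • y j ∈ S → e ∈ rhoTau (J → E1) := by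
    subst hy'
    exact hind
  let ψ : (J → E1) →ₗ[E1] N × (I → E1) := Fintype.linearCombination E1 y
  have hψ : ∀ e, ψ e = ∑ j, e j • y j := fun e => Fintype.linearCombination_apply E1 y e
  let k : M × (J → E1) →ₗ[E1] N × (I → E1) := g.coprod ψ
  have hk : ∀ p, k p = g p.1 + ψ p.2 := fun p => LinearMap.coprod_apply g ψ p
  have hkdeg : PreservesDegree (fun d => (ℳ d).prod (piGrading E1.grading η d)) ℬ k := by
    intro d p hp
    rw [hk, hψ]
    refine add_mem (hg d _ hp.1) (sum_mem fun j _ => ?_)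
    have := hB.smul_mem _ _ _ _ (mem_piGrading.1 hp.2 j) (hy j)
    rwa [sub_add_cancel] at this
  have hkbij : Function.Bijective k := by
    refine bijective_of_bijective_mod_rhoTau (hb.prod_piGrading η) hbB hB k hkdeg ?_ ?_
    · intro p hp
      rw [hk] at hp
      have h2 : p.2 ∈ rhoTau (J → E1) := by
        refine hind _ ?_
        rw [← hψ, hmemS]
        exact ⟨-p.1, by rwa [map_neg, sub_neg_eq_add, add_comm]⟩
      refine mem_rhoTau_prod_iff.2 ⟨hginj _ ?_, h2⟩
      have := sub_mem hp (map_mem_rhoTau ψ h2)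
      rwa [add_sub_cancel_right] at this
    · intro z
      obtain ⟨e, he⟩ := hgen z
      obtain ⟨x, hx⟩ := (hmemS _).1 he
      refine ⟨(x, e), ?_⟩
      rw [hk, hψ]
      convert hx using 1
      abel
  refine ⟨J → E1, I → E1, inferInstance, inferInstance, inferInstance, inferInstance,
    piGrading E1.grading η, piGrading E1.grading δ, LinearEquiv.ofBijective k hkbij,
    isGraded_piGrading η, isGradedFree_piGrading η, isGraded_piGrading δ, isGradedFree_piGrading δ,
    hkdeg, fun x => ?_⟩
  change (k (x, 0)).1 = f x
  rw [hk, map_zero, add_zero]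
  rfl

end

end C2Equivariant

/-- Whitehead theorem for Margolis homology over the `C₂`-equivariant algebra `ℰ(1)`. -/
theorem mainTheorem9 {M N : Type u}
    [AddCommGroup M] [Module C2Equivariant.E1 M] [AddCommGroup N] [Module C2Equivariant.E1 N]
    (ℳ : ℤ × ℤ → AddSubgroup M) (𝒩 : ℤ × ℤ → AddSubgroup N)
    (hM : C2Equivariant.IsGraded ℳ) (hN : C2Equivariant.IsGraded 𝒩)
    (hMfin : Module.Finite C2Equivariant.E1 M) (hNfin : Module.Finite C2Equivariant.E1 N)
    (hMfree : C2Equivariant.IsGradedM2Free ℳ) (hNfree : C2Equivariant.IsGradedM2Free 𝒩)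
    (f : M →ₗ[C2Equivariant.E1] N) (hf : C2Equivariant.PreservesDegree ℳ 𝒩 f) :
    C2Equivariant.IsStableEquiv ℳ 𝒩 f ↔
      ∀ i : Fin 2, Function.Bijective
        (C2Equivariant.mapMargolis (C2Equivariant.E1.Q i) (C2Equivariant.mapModRhoTau f)) :=
  ⟨fun h i => C2Equivariant.bijective_mapMargolis_of_isStableEquiv h i, fun h =>
    C2Equivariant.isStableEquiv_of_bijective_mapMargolis hM hN hMfin hNfin hMfree hNfree f hf h⟩
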